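/- Let $K\in\mathbb N$ and consider the two-period censored regression model $$Y_\tau=\max\{0,\alpha+\boldsymbol X_\tau^\top\boldsymbol\theta_0+\varepsilon_\tau\},\qquad \tau\in\{1,2\},$$ with regressors $\boldsymbol X_\tau\in\mathbb R^K$, parameter $\boldsymbol\theta_0\in\mathbb R^K$, fixed effect $\alpha$ and errors $\varepsilon_\tau$. Write $\Delta\boldsymbol X=\boldsymbol X_1-\boldsymbol X_2$, $\boldsymbol Y=(Y_1,Y_2)$, $\boldsymbol W=(\boldsymbol X_1,\boldsymbol X_2,\alpha)$. The trimmed square loss is, for $t\in\mathbb R$ and $\boldsymbol y\in[0,\infty)^2$, $$m(t,\boldsymbol y)=\frac12\begin{cases}y_1^2-2(y_2+t)y_1,&t\le -y_2,\\(y_1-y_2-t)^2,&-y_2<t<y_1,\\y_2^2+2(t-y_1)y_2,&t\ge y_1,\end{cases} \qquad \dot m_1(t,\boldsymbol y)=\frac{\partial m}{\partial t}(t,\boldsymbol y)=\begin{cases}-y_1,&t\le -y_2,\\y_2-y_1+t,&-y_2<t<y_1,\\y_2,&t\ge y_1.\end{cases}$$ Let $\boldsymbol Z_i=(Y_{i1},\boldsymbol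 X_{i1},Y_{i2},\boldsymbol X_{i2})$, $i=1,2,\dots$, be i.i.d. with the distribution of $(Y_1,\boldsymbol X_1,Y_2,\boldsymbol X_2)$, and for each $n\ge1$ let $\widehat{\boldsymbol\theta}_n$ be any minimizer over $\boldsymbol\theta\in\mathbb R^K$ of $\frac1n\sum_{i=1}^n m(\Delta\boldsymbol X_i^\top\boldsymbol\theta,\boldsymbol Y_i)$ (the TLS estimator). Assume: 1. $\mathbb P(Y_1>0,Y_2>0)>0$. 2. $\mathrm E\|\boldsymbol X_1\|_2^4$, $\mathrm E\|\boldsymbol X_2\|_2^4$, $\mathrm E[\alpha^2\|\Delta\boldsymbol X\|_2^4]$, $\mathrm E[\varepsilon_1^2\|\Delta\boldsymbol X\|_2^4]$, $\mathrm E[\varepsilon_2^2\|\Delta\boldsymbol X\|_2^4]$ are finite. 3. The conditional distribution of $(\varepsilon_1,\varepsilon_2)$ given $\boldsymbol W$ is absolutely continuous with respect to Lebesgue measure on $\mathbb R^2$. 4. Conditional on $\boldsymbol W$, $\varepsilon_1$ and $\varepsilon_2$ are exchangeable. 5. No proper linear subspace of $\mathbb R^K$ contains $\mathbf 1\{\mathbb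 P(Y_1>0,Y_2>0\mid\boldsymbol X_1,\boldsymbol X_2)>0\}\,\Delta\boldsymbol X$ with probability one. 6. No proper linear subspace of $\mathbb R^K$ contains $\big(\mathbf 1\{Y_1>0\}\mathbf 1\{\Delta\boldsymbol X^\top\boldsymbol\theta_0\le0\}+\mathbf 1\{Y_2>0\}\mathbf 1\{\Delta\boldsymbol X^\top\boldsymbol\theta_0>0\}\big)\Delta\boldsymbol X$ with probability one. 7. The expectations defining $\mathbf V_0:=\mathrm E[\dot m_1(\Delta\boldsymbol X^\top\boldsymbol\theta_0,\boldsymbol Y)^2\,\Delta\boldsymbol X\Delta\boldsymbol X^\top]$ exist in $\mathbb R^{K\times K}$, and $\mathbf V_0$ has full rank. Then $\boldsymbol G(\boldsymbol\theta):=\mathrm E[\dot m_1(\Delta\boldsymbol X^\top\boldsymbol\theta,\boldsymbol Y)\Delta\boldsymbol X]$ is well defined on $\mathbb R^K$ and differentiable at $\boldsymbol\theta_0$; let $\mathbf J_0:=\nabla\boldsymbol G(\boldsymbol\theta_0)$ be its Jacobian. Put $$\widehat{\mathbf V}_n=\frac1n\sum_{i=1}^n\dot m_1(\Delta\boldsymbol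 X_i^\top\widehat{\boldsymbol\theta}_n,\boldsymbol Y_i)^2\,\Delta\boldsymbol X_i\Delta\boldsymbol X_i^\top,$$ $$\widehat{\mathbf J}_n=\frac1n\sum_{i=1}^n\Big(\mathbf 1\{Y_{i1}>0\}\big(\mathbf 1\{\Delta\boldsymbol X_i^\top\widehat{\boldsymbol\theta}_n<0\}+\tfrac12\mathbf 1\{\Delta\boldsymbol X_i^\top\widehat{\boldsymbol\theta}_n=0\}\big)+\mathbf 1\{Y_{i2}>0\}\big(\mathbf 1\{\Delta\boldsymbol X_i^\top\widehat{\boldsymbol\theta}_n>0\}+\tfrac12\mathbf 1\{\Delta\boldsymbol X_i^\top\widehat{\boldsymbol\theta}_n=0\}\big)\Big)\Delta\boldsymbol X_i\Delta\boldsymbol X_i^\top.$$ Almost surely, as $n\to\infty$, $\widehat{\mathbf V}_n\to\mathbf V_0$ and $\widehat{\mathbf J}_n\to\mathbf J_0$. Consequently, $\mathbf J_0$ is invertible, almost surely $\widehat{\mathbf J}_n$ is invertible for all sufficiently large $n$, and $$\widehat{\mathbf J}_n^{-1}\widehat{\mathbf V}_n\widehat{\mathbf J}_n^{-1}\to\mathbf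 J_0^{-1}\mathbf V_0\mathbf J_0^{-1}\quad\text{almost surely.}$$ -/

import Mathlib

open MeasureTheory ProbabilityTheory Filter Topology

/-- Coefficient / regressor space `ℝ^K` with the Euclidean norm. -/
abbrev RVec (K : ℕ) : Type := EuclideanSpace ℝ (Fin K)

/-- The indicator `𝟏{p}` of a logical statement. -/
def ind (p : Prop) [Decidable p] : ℝ := if p then 1 else 0

/-- The outer product `v vᵀ`. -/
def outer {K : ℕ} (v : RVec K) : Matrix (Fin K) (Fin K) ℝ := Matrix.of fun j k => v j * v k

/-! ### The trimmed square loss and its derivative -/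

/-- The trimmed square loss `m(t, (y₁, y₂))`. -/
noncomputable def tlsLoss (t y₁ y₂ : ℝ) : ℝ :=
  (1 / 2) *
    (if t ≤ -y₂ then y₁ ^ 2 - 2 * (y₂ + t) * y₁
     else if t < y₁ then (y₁ - y₂ - t) ^ 2
     else y₂ ^ 2 + 2 * (t - y₁) * y₂)

/-- The partial derivative of the trimmed square loss in its first argument
(see `hasDerivAt_tlsLoss`). -/
noncomputable def tlsScore (t y₁ y₂ : ℝ) : ℝ :=
  if t ≤ -y₂ then -y₁
  else if t < y₁ then y₂ - y₁ + t
  else y₂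

theorem hasDerivAt_max_zero_sq (x : ℝ) :
    HasDerivAt (fun s : ℝ => max 0 s ^ 2) (2 * max 0 x) x := by
  rcases lt_trichotomy x 0 with h | h | h
  · have : (fun s : ℝ => max 0 s ^ 2) =ᶠ[𝓝 x] fun _ => 0 := by
      filter_upwards [gt_mem_nhds h] with s hs
      simp [max_eq_left hs.le]
    simpa [max_eq_left h.le] using (hasDerivAt_const x (0 : ℝ)).congr_of_eventuallyEq this
  · subst h
    rw [hasDerivAt_iff_isLittleO]
    simp only [max_self, sub_zero, mul_zero, smul_zero]
    have h1 : (fun s : ℝ => max 0 s ^ 2 - 0 ^ 2) =O[𝓝 0] fun s : ℝ => s ^ 2 := by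
      refine Asymptotics.IsBigO.of_bound 1 (Eventually.of_forall fun s => ?_)
      rcases le_total s 0 with hs | hs
      · simp [max_eq_left hs, sq_nonneg]
      · simp [max_eq_right hs]
    exact h1.trans_isLittleO (Asymptotics.isLittleO_pow_id one_lt_two)
  · have : (fun s : ℝ => max 0 s ^ 2) =ᶠ[𝓝 x] fun s => s ^ 2 := by
      filter_upwards [lt_mem_nhds h] with s hs
      simp [max_eq_right hs.le]
    simpa [max_eq_right h.le] using (hasDerivAt_pow 2 x).congr_of_eventuallyEq this

/-- On the domain `y₁, y₂ ≥ 0`, `tlsScore` is the derivative of `tlsLoss` in the first argument. -/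
theorem hasDerivAt_tlsLoss (t : ℝ) {y₁ y₂ : ℝ} (h₁ : 0 ≤ y₁) (h₂ : 0 ≤ y₂) :
    HasDerivAt (fun s => tlsLoss s y₁ y₂) (tlsScore t y₁ y₂) t := by
  have e : (fun s => tlsLoss s y₁ y₂) = fun s =>
      (1 / 2) * ((y₁ - y₂ - s) ^ 2 - max 0 (-y₂ - s) ^ 2 - max 0 (s - y₁) ^ 2) := by
    funext s
    unfold tlsLoss
    split_ifs with ha hb
    · rw [max_eq_right (by linarith), max_eq_left (by linarith)]; ring
    · rw [max_eq_left (by linarith), max_eq_left (by linarith)]; ring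
    · rw [max_eq_left (by linarith), max_eq_right (by linarith)]; ring
  rw [e]
  have d1 : HasDerivAt (fun s : ℝ => (y₁ - y₂ - s) ^ 2) (2 * (y₁ - y₂ - t) * (-1)) t := by
    have h := (hasDerivAt_pow 2 (y₁ - y₂ - t)).comp t ((hasDerivAt_id t).const_sub (y₁ - y₂))
    simpa [Function.comp_def] using h
  have d2 : HasDerivAt (fun s : ℝ => max 0 (-y₂ - s) ^ 2) (2 * max 0 (-y₂ - t) * (-1)) t :=
    HasDerivAt.comp (h₂ := fun s : ℝ => max 0 s ^ 2) t (hasDerivAt_max_zero_sq (-y₂ - t))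
      ((hasDerivAt_id t).const_sub (-y₂))
  have d3 : HasDerivAt (fun s : ℝ => max 0 (s - y₁) ^ 2) (2 * max 0 (t - y₁) * 1) t :=
    HasDerivAt.comp (h₂ := fun s : ℝ => max 0 s ^ 2) t (hasDerivAt_max_zero_sq (t - y₁))
      ((hasDerivAt_id t).sub_const y₁)
  refine (((d1.sub d2).sub d3).const_mul (1 / 2)).congr_deriv ?_
  unfold tlsScore
  split_ifs with ha hb
  · rw [max_eq_right (by linarith), max_eq_left (by linarith)]; ring
  · rw [max_eq_left (by linarith), max_eq_left (by linarith)]; ring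
  · rw [max_eq_left (by linarith), max_eq_right (by linarith)]; ring

/-! ### Observations and sample quantities -/

/-- An observation `(y₁, x₁, y₂, x₂)`: outcome and regressors in the two periods. -/
abbrev PanelObs (K : ℕ) : Type := ℝ × RVec K × ℝ × RVec K

namespace PanelObs

variable {K : ℕ}

/-- First-period outcome. -/
def y₁ (z : PanelObs K) : ℝ := z.1

/-- Second-period outcome. -/
def y₂ (z : PanelObs K) : ℝ := z.2.2.1

/-- The regressor difference `Δx = x₁ - x₂`. -/
def dx (z : PanelObs K) : RVec K := z.2.1 - z.2.2.2

/-- The index `Δxᵀ θ`. -/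
noncomputable def index (z : PanelObs K) (θ : RVec K) : ℝ := inner ℝ (dx z) θ

/-- The loss `m(Δxᵀ θ, y)`. -/
noncomputable def loss (z : PanelObs K) (θ : RVec K) : ℝ := tlsLoss (index z θ) (y₁ z) (y₂ z)

/-- The derivative `ṁ₁(Δxᵀ θ, y)`. -/
noncomputable def score (z : PanelObs K) (θ : RVec K) : ℝ := tlsScore (index z θ) (y₁ z) (y₂ z)

/-- The midpoint indicator weight
`𝟏{y₁ > 0} (𝟏{Δxᵀθ < 0} + ½ 𝟏{Δxᵀθ = 0}) + 𝟏{y₂ > 0} (𝟏{Δxᵀθ > 0} + ½ 𝟏{Δxᵀθ = 0})`. -/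
noncomputable def midWeight (z : PanelObs K) (θ : RVec K) : ℝ :=
  ind (0 < y₁ z) * (ind (index z θ < 0) + (1 / 2) * ind (index z θ = 0)) +
  ind (0 < y₂ z) * (ind (0 < index z θ) + (1 / 2) * ind (index z θ = 0))

end PanelObs

/-- The TLS sample criterion `θ ↦ n⁻¹ ∑_{i<n} m(Δxᵢᵀ θ, yᵢ)`. -/
noncomputable def tlsCriterion {K : ℕ} (z : ℕ → PanelObs K) (n : ℕ) (θ : RVec K) : ℝ :=
  (n : ℝ)⁻¹ * ∑ i ∈ Finset.range n, (z i).loss θ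

/-- The plug-in estimator `n⁻¹ ∑_{i<n} ṁ₁(Δxᵢᵀ θ, yᵢ)² Δxᵢ Δxᵢᵀ`, to be evaluated at `θ = θ̂`. -/
noncomputable def tlsVHat {K : ℕ} (z : ℕ → PanelObs K) (n : ℕ) (θ : RVec K) :
    Matrix (Fin K) (Fin K) ℝ :=
  (n : ℝ)⁻¹ • ∑ i ∈ Finset.range n, ((z i).score θ) ^ 2 • outer (z i).dx

/-- The plug-in Hessian estimator with midpoint indicators, to be evaluated at `θ = θ̂`. -/
noncomputable def tlsJHat {K : ℕ} (z : ℕ → PanelObs K) (n : ℕ) (θ : RVec K) :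
    Matrix (Fin K) (Fin K) ℝ :=
  (n : ℝ)⁻¹ • ∑ i ∈ Finset.range n, ((z i).midWeight θ) • outer (z i).dx

/-! ### The two-period censored regression model with fixed effects -/

/-- The primitives of the model: regressors, fixed effect, errors and the true parameter. -/
structure CensoredPanel (K : ℕ) (Ω : Type*) [MeasurableSpace Ω] where
  /-- First-period regressors. -/
  X₁ : Ω → RVec K
  /-- Second-period regressors. -/
  X₂ : Ω → RVec K
  /-- The fixed effect. -/
  α : Ω → ℝ
  /-- First-period error. -/
  ε₁ : Ω → ℝ
  /-- Second-period error. -/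
  ε₂ : Ω → ℝ
  /-- The true parameter. -/
  θ₀ : RVec K
  measurable_X₁ : Measurable X₁
  measurable_X₂ : Measurable X₂
  measurable_α : Measurable α
  measurable_ε₁ : Measurable ε₁
  measurable_ε₂ : Measurable ε₂

namespace CensoredPanel

variable {K : ℕ} {Ω : Type*} [mΩ : MeasurableSpace Ω] (M : CensoredPanel K Ω) (P : Measure Ω)

/-- First-period outcome `Y₁ = max {0, α + X₁ᵀ θ₀ + ε₁}`. -/
noncomputable def Y₁ (ω : Ω) : ℝ := max 0 (M.α ω + inner ℝ (M.X₁ ω) M.θ₀ + M.ε₁ ω)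

/-- Second-period outcome `Y₂ = max {0, α + X₂ᵀ θ₀ + ε₂}`. -/
noncomputable def Y₂ (ω : Ω) : ℝ := max 0 (M.α ω + inner ℝ (M.X₂ ω) M.θ₀ + M.ε₂ ω)

/-- The observable `(Y₁, X₁, Y₂, X₂)`. -/
noncomputable def obs (ω : Ω) : PanelObs K := (M.Y₁ ω, M.X₁ ω, M.Y₂ ω, M.X₂ ω)

/-- The regressor difference `ΔX = X₁ - X₂`. -/
def dX (ω : Ω) : RVec K := M.X₁ ω - M.X₂ ω

/-- The conditioning variables `W = (X₁, X₂, α)`. -/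
def W (ω : Ω) : RVec K × RVec K × ℝ := (M.X₁ ω, M.X₂ ω, M.α ω)

/-- The error pair `ε = (ε₁, ε₂)`. -/
def ε (ω : Ω) : ℝ × ℝ := (M.ε₁ ω, M.ε₂ ω)

/-- Non-degeneracy: `P(Y₁ > 0, Y₂ > 0) > 0`. -/
def NonDegenerate : Prop := 0 < P {ω | 0 < M.Y₁ ω ∧ 0 < M.Y₂ ω}

/-- Integrability conditions. -/
def MomentConditions : Prop :=
  Integrable (fun ω => ‖M.X₁ ω‖ ^ 4) P ∧
  Integrable (fun ω => ‖M.X₂ ω‖ ^ 4) P ∧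
  Integrable (fun ω => M.α ω ^ 2 * ‖M.dX ω‖ ^ 4) P ∧
  Integrable (fun ω => M.ε₁ ω ^ 2 * ‖M.dX ω‖ ^ 4) P ∧
  Integrable (fun ω => M.ε₂ ω ^ 2 * ‖M.dX ω‖ ^ 4) P

/-- The conditional distribution of `(ε₁, ε₂)` given `W` is absolutely continuous with respect to
Lebesgue measure on the plane. -/
def ContinuousErrors [IsFiniteMeasure P] : Prop :=
  ∀ᵐ w ∂(P.map M.W), condDistrib M.ε M.W P w ≪ (volume : Measure (ℝ × ℝ))

/-- Conditional on `W`, the errors `ε₁` and `ε₂` are exchangeable. -/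
def ExchangeableErrors [IsFiniteMeasure P] : Prop :=
  ∀ᵐ w ∂(P.map M.W), (condDistrib M.ε M.W P w).map Prod.swap = condDistrib M.ε M.W P w

/-- A version of the conditional probability `P(Y₁ > 0, Y₂ > 0 | X₁, X₂)`. -/
noncomputable def condProbBothPos : Ω → ℝ :=
  P[Set.indicator {ω | 0 < M.Y₁ ω ∧ 0 < M.Y₂ ω} (fun _ => (1 : ℝ)) |
    MeasurableSpace.comap (fun ω => (M.X₁ ω, M.X₂ ω)) inferInstance]

/-- Rank of regressors: no proper linear subspace contains
`𝟏{P(Y₁ > 0, Y₂ > 0 | X₁, X₂) > 0} ΔX` with probability one. -/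
def RankRegressors : Prop :=
  ∀ S : Submodule ℝ (RVec K),
    (∀ᵐ ω ∂P, ind (0 < M.condProbBothPos P ω) • M.dX ω ∈ S) → S = ⊤

/-- Score Jacobian invertibility condition: no proper linear subspace contains
`(𝟏{Y₁ > 0} 𝟏{ΔXᵀθ₀ ≤ 0} + 𝟏{Y₂ > 0} 𝟏{ΔXᵀθ₀ > 0}) ΔX` with probability one. -/
def JacobianRank : Prop :=
  ∀ S : Submodule ℝ (RVec K),
    (∀ᵐ ω ∂P, (ind (0 < M.Y₁ ω) * ind (inner ℝ (M.dX ω) M.θ₀ ≤ 0) +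
      ind (0 < M.Y₂ ω) * ind (0 < inner ℝ (M.dX ω) M.θ₀)) • M.dX ω ∈ S) → S = ⊤

/-- The expectations defining `V₀` exist and are finite. -/
def VExists : Prop :=
  ∀ j k : Fin K,
    Integrable (fun ω => ((M.obs ω).score M.θ₀) ^ 2 * outer (M.dX ω) j k) P

/-- The matrix `V₀ = E[ṁ₁(ΔXᵀθ₀, Y)² ΔX ΔXᵀ]`. -/
noncomputable def V₀ : Matrix (Fin K) (Fin K) ℝ :=
  Matrix.of fun j k => ∫ ω, ((M.obs ω).score M.θ₀) ^ 2 * outer (M.dX ω) j k ∂P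

/-- The expected score `G(θ) = E[ṁ₁(ΔXᵀθ, Y) ΔX]`. -/
noncomputable def G (θ : RVec K) : RVec K := ∫ ω, (M.obs ω).score θ • M.dX ω ∂P

/-- The Jacobian matrix `J₀ = ∇G(θ₀)`, with entries `∂G_j/∂θ_k (θ₀)`. -/
noncomputable def J₀ : Matrix (Fin K) (Fin K) ℝ :=
  Matrix.of fun j k => (fderiv ℝ (M.G P) M.θ₀ (EuclideanSpace.single k 1)) j

end CensoredPanel

/-- `Z₀, Z₁, …` is a random sample from the distribution of the observable of the model. -/
def IsRandomSample {K : ℕ} {Ω Ω' : Type*} [MeasurableSpace Ω] [MeasurableSpace Ω']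
    (M : CensoredPanel K Ω) (P : Measure Ω) (Z : ℕ → Ω' → PanelObs K) (Q : Measure Ω') : Prop :=
  iIndepFun Z Q ∧ ∀ i, IdentDistrib (Z i) M.obs Q P

/-- `θhat n` is a TLS estimator based on the first `n` observations, for every `n ≥ 1`: almost
surely, it is a global minimizer of the sample criterion. -/
def IsTLSEstimator {K : ℕ} {Ω' : Type*} [MeasurableSpace Ω']
    (Z : ℕ → Ω' → PanelObs K) (Q : Measure Ω') (θhat : ℕ → Ω' → RVec K) : Prop :=
  ∀ᵐ ω ∂Q, ∀ n : ℕ, 1 ≤ n →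
    ∀ θ : RVec K, tlsCriterion (fun i => Z i ω) n (θhat n ω) ≤ tlsCriterion (fun i => Z i ω) n θ

/-!
Exchanging the two errors, with the regressors and the fixed effect held fixed, changes the sign
of the score at `θ₀`, and it gives the same symmetrization to the midpoint weight at `θ₀`, to the
weight of the rank condition, and to the difference quotients of the score away from the kinks.
Hence the expected score `G` vanishes at `θ₀`, is differentiable there with derivative
`E[midWeight ΔX ΔXᵀ]`, and this derivative is positive definite by the rank condition. The loss is
convex and lies above its tangents, strictly in mean because of the rank condition, so the sample
criterion eventually exceeds its value at `θ₀` on every small sphere around `θ₀`: the estimator is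
strongly consistent. The score is Lipschitz in `θ`, which settles `V̂`.

For `Ĵ` the difficulty is that `Δxᵀθ₀` may vanish with positive probability: there the midpoint
weight at `θ̂` depends on the direction of `θ̂ - θ₀`, which need not converge. A law of large
numbers uniform over all half-spaces `{Δxᵀθ > 0}` reduces `Ĵ` to its expectation as a function of
`θ`, and this function is continuous at `θ₀` because on `{Δxᵀθ₀ = 0}` the two outcomes are
exchangeable.
-/

section UniformLaw

variable {Ω Ω' 𝒵 ι : Type*} [MeasurableSpace Ω] [MeasurableSpace Ω'] [MeasurableSpace 𝒵]
  {P : Measure Ω} {Q : Measure Ω'} {X : Ω → 𝒵} {Z : ℕ → Ω' → 𝒵} {F : ι → 𝒵 → ℝ}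

/-- The mean of `f` under the empirical distribution of the first `n` terms of `z`; it is `0` for
`n = 0`. -/
noncomputable def empiricalMean {𝒵 : Type*} (z : ℕ → 𝒵) (n : ℕ) (f : 𝒵 → ℝ) : ℝ :=
  (n : ℝ)⁻¹ * ∑ i ∈ Finset.range n, f (z i)

theorem empiricalMean_mono {𝒵 : Type*} {z : ℕ → 𝒵} {f g : 𝒵 → ℝ} (h : ∀ i, f (z i) ≤ g (z i))
    (n : ℕ) : empiricalMean z n f ≤ empiricalMean z n g := by
  unfold empiricalMean
  gcongr with i
  exact h i

theorem empiricalMean_add {𝒵 : Type*} (z : ℕ → 𝒵) (n : ℕ) (f g : 𝒵 → ℝ) :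
    empiricalMean z n (fun x => f x + g x) = empiricalMean z n f + empiricalMean z n g := by
  simp only [empiricalMean, Finset.sum_add_distrib, mul_add]

theorem empiricalMean_sub {𝒵 : Type*} (z : ℕ → 𝒵) (n : ℕ) (f g : 𝒵 → ℝ) :
    empiricalMean z n (fun x => f x - g x) = empiricalMean z n f - empiricalMean z n g := by
  simp only [empiricalMean, Finset.sum_sub_distrib, mul_sub]

theorem empiricalMean_const_mul {𝒵 : Type*} (z : ℕ → 𝒵) (n : ℕ) (c : ℝ) (f : 𝒵 → ℝ) :
    empiricalMean z n (fun x => c * f x) = c * empiricalMean z n f := by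
  rw [empiricalMean, ← Finset.mul_sum, mul_left_comm, empiricalMean]

theorem abs_empiricalMean_le {𝒵 : Type*} (z : ℕ → 𝒵) (n : ℕ) (f : 𝒵 → ℝ) :
    |empiricalMean z n f| ≤ empiricalMean z n fun x => |f x| := by
  rw [empiricalMean, abs_mul, abs_of_nonneg (by positivity : (0 : ℝ) ≤ (n : ℝ)⁻¹)]
  exact mul_le_mul_of_nonneg_left (Finset.abs_sum_le_sum_abs _ _) (by positivity)

theorem ae_tendsto_empiricalMean (hindep : Pairwise fun i j => IndepFun (Z i) (Z j) Q)
    (hid : ∀ i, IdentDistrib (Z i) X Q P) {f : 𝒵 → ℝ} (hf : Measurable f)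
    (hint : Integrable (fun ω => f (X ω)) P) :
    ∀ᵐ ω ∂Q, Tendsto (fun n => empiricalMean (Z · ω) n f) atTop (𝓝 (∫ ω, f (X ω) ∂P)) := by
  have hid' (i : ℕ) : IdentDistrib (fun ω => f (Z i ω)) (fun ω => f (X ω)) Q P := (hid i).comp hf
  have hlln := strong_law_ae_real (fun i ω => f (Z i ω)) ((hid' 0).integrable_iff.2 hint)
    (fun i j hij => (hindep hij).comp hf hf) (fun i => (hid' i).trans (hid' 0).symm)
  filter_upwards [hlln] with ω hω
  simpa only [empiricalMean, div_eq_inv_mul, (hid' 0).integral_eq] using hω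

/-- The family `F` has finite `L¹` bracketing numbers under the law of `X`: for every `ε > 0`,
finitely many brackets `[l, u]` with `E[u(X) - l(X)] ≤ ε` contain all its members. -/
def HasFiniteBracketing (X : Ω → 𝒵) (P : Measure Ω) (F : ι → 𝒵 → ℝ) : Prop :=
  ∀ ε > 0, ∃ B : Set ((𝒵 → ℝ) × (𝒵 → ℝ)), B.Finite ∧
    (∀ b ∈ B, Measurable b.1 ∧ Measurable b.2 ∧ Integrable (fun ω => b.1 (X ω)) P ∧
      Integrable (fun ω => b.2 (X ω)) P ∧ ∫ ω, b.2 (X ω) ∂P ≤ ∫ ω, b.1 (X ω) ∂P + ε) ∧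
    ∀ t, ∃ b ∈ B, b.1 ≤ F t ∧ F t ≤ b.2

/-- The Glivenko–Cantelli theorem for a family with finite bracketing numbers. -/
theorem HasFiniteBracketing.ae_tendstoUniformly (hF : HasFiniteBracketing X P F)
    (hint : ∀ t, Integrable (fun ω => F t (X ω)) P)
    (hindep : Pairwise fun i j => IndepFun (Z i) (Z j) Q)
    (hid : ∀ i, IdentDistrib (Z i) X Q P) :
    ∀ᵐ ω ∂Q, TendstoUniformly (fun n t => empiricalMean (Z · ω) n (F t))
      (fun t => ∫ ω, F t (X ω) ∂P) atTop := by
  choose B hfin hB hcover using fun m : ℕ => hF (1 / ((m : ℝ) + 1)) Nat.one_div_pos_of_nat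
  have hlln : ∀ᵐ ω ∂Q, ∀ m, ∀ b ∈ B m,
      Tendsto (fun n => empiricalMean (Z · ω) n b.1) atTop (𝓝 (∫ ω, b.1 (X ω) ∂P)) ∧
      Tendsto (fun n => empiricalMean (Z · ω) n b.2) atTop (𝓝 (∫ ω, b.2 (X ω) ∂P)) := by
    refine ae_all_iff.2 fun m => (ae_ball_iff (hfin m).countable).2 fun b hb => ?_
    obtain ⟨hl, hu, hli, hui, -⟩ := hB m b hb
    exact (ae_tendsto_empiricalMean hindep hid hl hli).and
      (ae_tendsto_empiricalMean hindep hid hu hui)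
  filter_upwards [hlln] with ω hω
  refine Metric.tendstoUniformly_iff.2 fun ε hε => ?_
  obtain ⟨m, hm⟩ := exists_nat_one_div_lt (half_pos hε)
  have hclose : ∀ᶠ n in atTop, ∀ b ∈ B m,
      ∫ ω, b.1 (X ω) ∂P - ε / 2 < empiricalMean (Z · ω) n b.1 ∧
      empiricalMean (Z · ω) n b.2 < ∫ ω, b.2 (X ω) ∂P + ε / 2 :=
    (eventually_all_finite (hfin m)).2 fun b hb =>
      ((hω m b hb).1.eventually_const_lt (by linarith)).and
        ((hω m b hb).2.eventually_lt_const (by linarith))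
  filter_upwards [hclose] with n hn t
  obtain ⟨b, hb, hle, hge⟩ := hcover m t
  obtain ⟨-, -, hli, hui, hgap⟩ := hB m b hb
  have hl : ∫ ω, b.1 (X ω) ∂P ≤ ∫ ω, F t (X ω) ∂P := integral_mono hli (hint t) fun ω => hle (X ω)
  have hu : ∫ ω, F t (X ω) ∂P ≤ ∫ ω, b.2 (X ω) ∂P := integral_mono (hint t) hui fun ω => hge (X ω)
  have hl' := empiricalMean_mono (z := (Z · ω)) (fun i => hle _) n
  have hu' := empiricalMean_mono (z := (Z · ω)) (fun i => hge _) n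
  rw [Real.dist_eq, abs_lt]
  constructor <;> linarith [(hn b hb).1, (hn b hb).2]

end UniformLaw

section Bracketing

variable {E : Type*} [MeasurableSpace E] {μ : Measure E} {ε : ENNReal} {C D : Set (Set E)}

/-- Finitely many brackets `s ⊆ t` with `μ (t \ s) ≤ ε` contain all the sets in `C`. -/
def HasSetBracketing (μ : Measure E) (ε : ENNReal) (C : Set (Set E)) : Prop :=
  ∃ B : Set (Set E × Set E), B.Finite ∧
    (∀ b ∈ B, MeasurableSet b.1 ∧ MeasurableSet b.2 ∧ μ (b.2 \ b.1) ≤ ε) ∧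
    ∀ s ∈ C, ∃ b ∈ B, b.1 ⊆ s ∧ s ⊆ b.2

namespace HasSetBracketing

theorem singleton_empty : HasSetBracketing μ ε {∅} :=
  ⟨{(∅, ∅)}, Set.finite_singleton _, by simp, by simp⟩

theorem mono (hD : HasSetBracketing μ ε D) (hCD : C ⊆ D) : HasSetBracketing μ ε C :=
  let ⟨B, hfin, hB, hcover⟩ := hD
  ⟨B, hfin, hB, fun s hs => hcover s (hCD hs)⟩

theorem union (hC : HasSetBracketing μ ε C) (hD : HasSetBracketing μ ε D) :
    HasSetBracketing μ ε (C ∪ D) := by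
  obtain ⟨A, hAfin, hA, hAcover⟩ := hC
  obtain ⟨B, hBfin, hB, hBcover⟩ := hD
  refine ⟨A ∪ B, hAfin.union hBfin, fun b hb => hb.elim (hA b) (hB b), ?_⟩
  rintro s (hs | hs)
  · obtain ⟨b, hb, h⟩ := hAcover s hs
    exact ⟨b, Or.inl hb, h⟩
  · obtain ⟨b, hb, h⟩ := hBcover s hs
    exact ⟨b, Or.inr hb, h⟩

theorem preimage {𝒵 : Type*} [MeasurableSpace 𝒵] {ν : Measure 𝒵} {d : 𝒵 → E} (hd : Measurable d)
    (hC : HasSetBracketing (ν.map d) ε C) : HasSetBracketing ν ε ((d ⁻¹' ·) '' C) := by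
  obtain ⟨B, hfin, hB, hcover⟩ := hC
  refine ⟨(fun b => (d ⁻¹' b.1, d ⁻¹' b.2)) '' B, hfin.image _, ?_, ?_⟩
  · rintro _ ⟨b, hb, rfl⟩
    obtain ⟨hl, hu, hgap⟩ := hB b hb
    rw [Measure.map_apply hd (hu.diff hl)] at hgap
    exact ⟨hd hl, hd hu, hgap⟩
  · rintro _ ⟨s, hs, rfl⟩
    obtain ⟨b, hb, hl, hu⟩ := hcover s hs
    exact ⟨_, ⟨b, hb, rfl⟩, Set.preimage_mono hl, Set.preimage_mono hu⟩

end HasSetBracketing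

theorem hasFiniteBracketing_indicator {Ω 𝒵 ι : Type*} [MeasurableSpace Ω] [MeasurableSpace 𝒵]
    {P : Measure Ω} {X : Ω → 𝒵} (hX : Measurable X) {a : 𝒵 → ℝ} (ha : Measurable a)
    (ha0 : 0 ≤ a) (hint : Integrable (fun ω => a (X ω)) P) {s : ι → Set 𝒵}
    (hs : ∀ ε > 0, HasSetBracketing
      ((P.withDensity fun ω => ENNReal.ofReal (a (X ω))).map X) ε (Set.range s)) :
    HasFiniteBracketing X P fun t => (s t).indicator a := by
  intro ε hε
  obtain ⟨B, hfin, hB, hcover⟩ := hs (ENNReal.ofReal ε) (ENNReal.ofReal_pos.2 hε)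
  have hinti {t : Set 𝒵} (ht : MeasurableSet t) : Integrable (fun ω => t.indicator a (X ω)) P :=
    hint.indicator (hX ht)
  refine ⟨(fun b => (b.1.indicator a, b.2.indicator a)) '' B, hfin.image _, ?_, fun t => ?_⟩
  · rintro _ ⟨⟨l, u⟩, hb, rfl⟩
    obtain ⟨hl, hu, hgap⟩ := hB _ hb
    refine ⟨ha.indicator hl, ha.indicator hu, hinti hl, hinti hu, ?_⟩
    have hmeas : MeasurableSet (X ⁻¹' (u \ l)) := hX (hu.diff hl)
    have hdiff : ∫ ω, (u \ l).indicator a (X ω) ∂P ≤ ε := by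
      rw [Measure.map_apply hX (hu.diff hl), withDensity_apply _ hmeas] at hgap
      calc ∫ ω, (u \ l).indicator a (X ω) ∂P = ∫ ω in X ⁻¹' (u \ l), a (X ω) ∂P :=
            integral_indicator hmeas
        _ = (∫⁻ ω in X ⁻¹' (u \ l), ENNReal.ofReal (a (X ω)) ∂P).toReal :=
            integral_eq_lintegral_of_nonneg_ae (Eventually.of_forall fun ω => ha0 _)
              hint.aestronglyMeasurable.restrict
        _ ≤ ε := ENNReal.toReal_le_of_le_ofReal hε.le hgap
    calc ∫ ω, u.indicator a (X ω) ∂P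
        ≤ ∫ ω, (l.indicator a (X ω) + (u \ l).indicator a (X ω)) ∂P := by
          refine integral_mono (hinti hu) ((hinti hl).add (hinti (hu.diff hl))) fun ω => ?_
          have : 0 ≤ a (X ω) := ha0 (X ω)
          by_cases hωl : X ω ∈ l <;> by_cases hωu : X ω ∈ u <;> simp [hωl, hωu, this]
      _ = ∫ ω, l.indicator a (X ω) ∂P + ∫ ω, (u \ l).indicator a (X ω) ∂P :=
          integral_add (hinti hl) (hinti (hu.diff hl))
      _ ≤ ∫ ω, l.indicator a (X ω) ∂P + ε := by gcongr
  · obtain ⟨b, hb, hl, hu⟩ := hcover (s t) ⟨t, rfl⟩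
    exact ⟨_, ⟨b, hb, rfl⟩, Set.indicator_le_indicator_of_subset hl ha0,
      Set.indicator_le_indicator_of_subset hu ha0⟩

end Bracketing

section HalfSpace

variable {E : Type*} [NormedAddCommGroup E] [InnerProductSpace ℝ E]

/-- The part of the subspace `S` in the open half-space of vectors at an acute angle to `u`. -/
def posHalf (S : Submodule ℝ E) (u : E) : Set E := {x | x ∈ S ∧ 0 < inner ℝ x u}

theorem posHalf_smul {c : ℝ} (hc : 0 < c) (S : Submodule ℝ E) (u : E) :
    posHalf S (c • u) = posHalf S u := by
  simp only [posHalf, inner_smul_right, mul_pos_iff_of_pos_left hc]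

theorem posHalf_zero (S : Submodule ℝ E) : posHalf S 0 = ∅ := by
  simp only [posHalf, inner_zero_right, lt_irrefl, and_false, Set.ofPred_false]

theorem posHalf_starProjection (S : Submodule ℝ E) [S.HasOrthogonalProjection] (u : E) :
    posHalf S (S.starProjection u) = posHalf S u := by
  ext x
  refine and_congr_right fun hx => ?_
  rw [← Submodule.inner_starProjection_left_eq_right, Submodule.starProjection_eq_self_iff.2 hx]

theorem range_posHalf_subset (S : Submodule ℝ E) [S.HasOrthogonalProjection] :
    Set.range (posHalf S) ⊆ {∅} ∪ posHalf S '' (Metric.sphere 0 1 ∩ S) := by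
  rintro _ ⟨u, rfl⟩
  rw [← posHalf_starProjection]
  set v := S.starProjection u
  have hvS : v ∈ S := S.starProjection_apply_mem u
  rcases eq_or_ne v 0 with hv | hv
  · exact Or.inl (hv ▸ posHalf_zero S)
  · refine Or.inr ⟨‖v‖⁻¹ • v, ⟨?_, S.smul_mem _ hvS⟩, posHalf_smul (by positivity) S v⟩
    simpa using norm_smul_inv_norm (𝕜 := ℝ) hv

variable [MeasurableSpace E] [BorelSpace E]

theorem exists_measure_slab_le (μ : Measure E) [IsFiniteMeasure μ] (u : E) {ε : ENNReal}
    (hε : 0 < ε) :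
    ∃ δ > 0, μ {x | (inner ℝ x u : ℝ) ≠ 0 ∧ |(inner ℝ x u : ℝ)| ≤ δ * ‖x‖} ≤ ε := by
  set D : ℕ → Set E := fun k =>
    {x | (inner ℝ x u : ℝ) ≠ 0 ∧ |(inner ℝ x u : ℝ)| ≤ 1 / ((k : ℝ) + 1) * ‖x‖}
  have hmeas (k : ℕ) : MeasurableSet (D k) := by measurability
  have hanti : Antitone D := fun k l hkl x hx => ⟨hx.1, hx.2.trans (by gcongr)⟩
  have hempty : ⋂ k, D k = ∅ := by
    refine Set.eq_empty_iff_forall_notMem.2 fun x hx => ?_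
    rw [Set.mem_iInter] at hx
    have hlim : Tendsto (fun k : ℕ => 1 / ((k : ℝ) + 1) * ‖x‖) atTop (𝓝 (0 * ‖x‖)) :=
      tendsto_one_div_add_atTop_nhds_zero_nat.mul_const _
    have hle := ge_of_tendsto' hlim fun k => (hx k).2
    exact (hx 0).1 (abs_nonpos_iff.1 (by simpa using hle))
  have hlim := tendsto_measure_iInter_atTop (μ := μ) (fun k => (hmeas k).nullMeasurableSet) hanti
    ⟨0, measure_ne_top _ _⟩
  rw [hempty, measure_empty] at hlim
  obtain ⟨k, hk⟩ := (hlim.eventually_le_const hε).exists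
  exact ⟨_, Nat.one_div_pos_of_nat, hk⟩

variable [FiniteDimensional ℝ E]

/-- For `u` near `u₀`, membership in `posHalf S u` is decided by the sign of `inner x u₀` outside a
thin slab around `u₀ᗮ`, and by `posHalf (S ⊓ u₀ᗮ) u` on `u₀ᗮ`. -/
theorem HasSetBracketing.exists_posHalf_closedBall {μ : Measure E} [IsFiniteMeasure μ]
    {S : Submodule ℝ E} {u₀ : E} {ε : ENNReal} (hε : 0 < ε)
    (hbr : HasSetBracketing μ (ε / 2) (Set.range (posHalf (S ⊓ (ℝ ∙ u₀)ᗮ)))) :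
    ∃ δ > 0, HasSetBracketing μ ε (posHalf S '' Metric.closedBall u₀ δ) := by
  obtain ⟨B, hfin, hB, hcover⟩ := hbr
  obtain ⟨δ, hδ, hslab⟩ := exists_measure_slab_le μ u₀ (ENNReal.half_pos hε.ne')
  set D : Set E := {x | (inner ℝ x u₀ : ℝ) ≠ 0 ∧ |(inner ℝ x u₀ : ℝ)| ≤ δ * ‖x‖}
  set A : Set E := {x | x ∈ S ∧ δ * ‖x‖ < inner ℝ x u₀}
  have hD : MeasurableSet D := by measurability
  have hA : MeasurableSet A := S.closed_of_finiteDimensional.measurableSet.inter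
    (measurableSet_lt (measurable_norm.const_mul δ) (by fun_prop))
  refine ⟨δ, hδ, (fun b => (b.1 ∪ A, b.2 ∪ D ∪ A)) '' B, hfin.image _, ?_, ?_⟩
  · rintro _ ⟨b, hb, rfl⟩
    obtain ⟨hl, hu, hgap⟩ := hB b hb
    refine ⟨hl.union hA, (hu.union hD).union hA, ?_⟩
    calc μ ((b.2 ∪ D ∪ A) \ (b.1 ∪ A)) ≤ μ (b.2 \ b.1 ∪ D) := measure_mono (by grind)
      _ ≤ μ (b.2 \ b.1) + μ D := measure_union_le _ _
      _ ≤ ε / 2 + ε / 2 := add_le_add hgap hslab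
      _ = ε := ENNReal.add_halves ε
  · rintro _ ⟨u, hu, rfl⟩
    have hclose (x : E) : |(inner ℝ x u : ℝ) - inner ℝ x u₀| ≤ δ * ‖x‖ := by
      rw [← inner_sub_right, mul_comm]
      exact (abs_real_inner_le_norm _ _).trans (by gcongr; exact mem_closedBall_iff_norm.1 hu)
    obtain ⟨b, hb, hlower, hupper⟩ := hcover _ ⟨u, rfl⟩
    refine ⟨_, ⟨b, hb, rfl⟩, Set.union_subset (fun x hx => ?_) fun x hx => ⟨hx.1, ?_⟩, ?_⟩
    · exact ⟨(hlower hx).1.1, (hlower hx).2⟩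
    · linarith [(abs_le.1 (hclose x)).1, hx.2]
    · rintro x ⟨hxS, hxu⟩
      by_cases h0 : (inner ℝ x u₀ : ℝ) = 0
      · exact Or.inl (Or.inl (hupper
          ⟨⟨hxS, Submodule.mem_orthogonal_singleton_iff_inner_left.2 h0⟩, hxu⟩))
      by_cases hD' : |(inner ℝ x u₀ : ℝ)| ≤ δ * ‖x‖
      · exact Or.inl (Or.inr ⟨h0, hD'⟩)
      · refine Or.inr ⟨hxS, (lt_abs.1 (not_le.1 hD')).resolve_right fun h => ?_⟩
        linarith [(abs_le.1 (hclose x)).2]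

theorem hasSetBracketing_posHalf (μ : Measure E) [IsFiniteMeasure μ] (S : Submodule ℝ E)
    {ε : ENNReal} (hε : 0 < ε) : HasSetBracketing μ ε (Set.range (posHalf S)) := by
  induction S using WellFoundedLT.induction generalizing ε with
  | ind S ih =>
    have hlocal : ∀ u₀ ∈ Metric.sphere (0 : E) 1 ∩ S,
        ∃ δ > 0, HasSetBracketing μ ε (posHalf S '' Metric.closedBall u₀ δ) := by
      rintro u₀ ⟨hu₀, hu₀S⟩
      refine HasSetBracketing.exists_posHalf_closedBall hε (ih _ ?_ (ENNReal.half_pos hε.ne'))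
      refine lt_of_le_of_ne inf_le_left fun h => ?_
      have hinner := Submodule.mem_orthogonal_singleton_iff_inner_left.1 (h ▸ hu₀S : u₀ ∈ S ⊓ _).2
      rw [inner_self_eq_zero.1 hinner] at hu₀
      simp at hu₀
    have hcompact : IsCompact (Metric.sphere (0 : E) 1 ∩ S) :=
      (isCompact_sphere 0 1).inter_right S.closed_of_finiteDimensional
    refine (HasSetBracketing.singleton_empty.union ?_).mono (range_posHalf_subset S)
    refine hcompact.induction_on (p := fun U => HasSetBracketing μ ε (posHalf S '' U)) ?_
      (fun U V hUV hV => hV.mono (Set.image_mono hUV))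
      (fun U V hU hV => Set.image_union _ U V ▸ hU.union hV) fun u₀ hu₀ => ?_
    · exact HasSetBracketing.singleton_empty.mono (by simp)
    · obtain ⟨δ, hδ, hbr⟩ := hlocal u₀ hu₀
      exact ⟨_, mem_nhdsWithin_of_mem_nhds (Metric.closedBall_mem_nhds u₀ hδ), hbr⟩

variable {Ω Ω' 𝒵 : Type*} [MeasurableSpace Ω] [MeasurableSpace Ω'] [MeasurableSpace 𝒵]
  {P : Measure Ω} {Q : Measure Ω'} {X : Ω → 𝒵} {Z : ℕ → Ω' → 𝒵} {a : 𝒵 → ℝ} {d : 𝒵 → E}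

theorem hasFiniteBracketing_indicator_halfSpace (hX : Measurable X) (ha : Measurable a)
    (ha0 : 0 ≤ a) (hint : Integrable (fun ω => a (X ω)) P) (hd : Measurable d) :
    HasFiniteBracketing X P fun u : E => {z | 0 < inner ℝ (d z) u}.indicator a := by
  have := isFiniteMeasure_withDensity_ofReal hint.2
  refine hasFiniteBracketing_indicator hX ha ha0 hint fun ε hε => ?_
  refine ((hasSetBracketing_posHalf _ ⊤ hε).preimage hd).mono ?_
  rintro _ ⟨u, rfl⟩
  exact ⟨_, ⟨u, rfl⟩, by simp [posHalf]⟩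

theorem measurableSet_halfSpace (hd : Measurable d) (u : E) :
    MeasurableSet {z | 0 < (inner ℝ (d z) u : ℝ)} :=
  measurableSet_lt measurable_const (hd.inner_const)

theorem ae_tendstoUniformly_empiricalMean_halfSpace
    (hindep : Pairwise fun i j => IndepFun (Z i) (Z j) Q)
    (hid : ∀ i, IdentDistrib (Z i) X Q P) (hX : Measurable X) (ha : Measurable a)
    (hint : Integrable (fun ω => a (X ω)) P) (hd : Measurable d) :
    ∀ᵐ ω ∂Q, TendstoUniformly
      (fun n (u : E) => empiricalMean (Z · ω) n ({z | 0 < inner ℝ (d z) u}.indicator a))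
      (fun u => ∫ ω, {z | 0 < inner ℝ (d z) u}.indicator a (X ω) ∂P) atTop := by
  have hsplit (u : E) : {z | 0 < inner ℝ (d z) u}.indicator a = fun z =>
      {z | 0 < inner ℝ (d z) u}.indicator (fun z => max (a z) 0) z -
        {z | 0 < inner ℝ (d z) u}.indicator (fun z => max (-a z) 0) z := by
    rw [← Set.indicator_sub]
    congr with z
    exact (max_zero_sub_eq_self (a z)).symm
  have hpos (u : E) : Integrable (fun ω =>
      {z | 0 < inner ℝ (d z) u}.indicator (fun z => max (a z) 0) (X ω)) P :=
    hint.pos_part.indicator (hX (measurableSet_halfSpace hd u))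
  have hneg (u : E) : Integrable (fun ω =>
      {z | 0 < inner ℝ (d z) u}.indicator (fun z => max (-a z) 0) (X ω)) P :=
    hint.neg_part.indicator (hX (measurableSet_halfSpace hd u))
  have hlim_pos := (hasFiniteBracketing_indicator_halfSpace hX (ha.max measurable_const)
    (fun z => le_max_right _ _) hint.pos_part hd).ae_tendstoUniformly hpos hindep hid
  have hlim_neg := (hasFiniteBracketing_indicator_halfSpace hX (ha.neg.max measurable_const)
    (fun z => le_max_right _ _) hint.neg_part hd).ae_tendstoUniformly hneg hindep hid
  filter_upwards [hlim_pos, hlim_neg] with ω hω hω'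
  simp only [hsplit, empiricalMean_sub, integral_sub (hpos _) (hneg _)]
  exact hω.sub hω'

end HalfSpace

section ConvexConsistency

theorem dist_lt_of_convexOn_of_forall_sphere_lt {E : Type*} [NormedAddCommGroup E] [NormedSpace ℝ E]
    {f : E → ℝ} (hf : ConvexOn ℝ Set.univ f) {x₀ x : E} {r : ℝ} (hr : 0 < r)
    (hsphere : ∀ y ∈ Metric.sphere x₀ r, f x₀ < f y) (hx : f x ≤ f x₀) : dist x x₀ < r := by
  by_contra! hle
  have hpos : 0 < dist x₀ x := by rw [dist_comm]; exact hr.trans_le hle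
  set y := AffineMap.lineMap x₀ x (r / dist x₀ x)
  have hy : y ∈ Metric.sphere x₀ r := by
    rw [Metric.mem_sphere, dist_lineMap_left, Real.norm_of_nonneg (by positivity),
      div_mul_cancel₀ _ hpos.ne']
  have hseg : y ∈ segment ℝ x₀ x := by
    rw [segment_eq_image_lineMap]
    exact ⟨_, ⟨by positivity, (div_le_one hpos).2 (by rwa [dist_comm])⟩, rfl⟩
  have hmax := hf.le_on_segment (Set.mem_univ x₀) (Set.mem_univ x) hseg
  exact absurd (hsphere y hy) (by simpa [hx] using hmax)

theorem ae_eventually_forall_empiricalMean_pos {Ω Ω' 𝒵 ι : Type*} [MeasurableSpace Ω]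
    [MeasurableSpace Ω'] [MeasurableSpace 𝒵] [PseudoMetricSpace ι] {P : Measure Ω} {Q : Measure Ω'}
    {X : Ω → 𝒵} {Z : ℕ → Ω' → 𝒵} {F : ι → 𝒵 → ℝ} {L : 𝒵 → ℝ} {C : Set ι}
    (hindep : Pairwise fun i j => IndepFun (Z i) (Z j) Q) (hid : ∀ i, IdentDistrib (Z i) X Q P)
    (hC : IsCompact C) (hF : ∀ t ∈ C, Measurable (F t))
    (hint : ∀ t ∈ C, Integrable (fun ω => F t (X ω)) P) (hpos : ∀ t ∈ C, 0 < ∫ ω, F t (X ω) ∂P)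
    (hL : Measurable L) (hLint : Integrable (fun ω => L (X ω)) P)
    (hlip : ∀ᵐ ω ∂Q, ∀ i, ∀ s ∈ C, ∀ t ∈ C,
      F s (Z i ω) - F t (Z i ω) ≤ L (Z i ω) * dist s t) :
    ∀ᵐ ω ∂Q, ∀ᶠ n in atTop, ∀ t ∈ C, 0 < empiricalMean (Z · ω) n (F t) := by
  set c : ℝ := ∫ ω, |L (X ω)| ∂P
  have hc : 0 ≤ c := integral_nonneg fun ω => abs_nonneg _
  set δ : ι → ℝ := fun t => (∫ ω, F t (X ω) ∂P) / (c + 1) with hδ_def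
  have hδ {t : ι} (ht : t ∈ C) : 0 < δ t := div_pos (hpos t ht) (by linarith)
  obtain ⟨T, hTC, hcover⟩ := hC.elim_nhds_subcover (fun t => Metric.ball t (δ t))
    fun t ht => Metric.ball_mem_nhds t (hδ ht)
  set f : ι → 𝒵 → ℝ := fun t z => F t z - |L z| * δ t
  have hf_pos {t : ι} (ht : t ∈ C) : 0 < ∫ ω, f t (X ω) ∂P := by
    have heq : ∫ ω, F t (X ω) ∂P = δ t * (c + 1) := by rw [hδ_def]; field_simp
    rw [integral_sub (hint t ht) (hLint.abs.mul_const _), integral_mul_const, heq]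
    linarith [hδ ht]
  have hlln : ∀ᵐ ω ∂Q, ∀ t ∈ T,
      Tendsto (fun n => empiricalMean (Z · ω) n (f t)) atTop (𝓝 (∫ ω, f t (X ω) ∂P)) :=
    (ae_ball_iff T.countable_toSet).2 fun t ht => ae_tendsto_empiricalMean hindep hid
      ((hF t (hTC t ht)).sub (hL.abs.mul_const _))
      ((hint t (hTC t ht)).sub (hLint.abs.mul_const _))
  filter_upwards [hlln, hlip] with ω hω hω'
  have hT : ∀ᶠ n in atTop, ∀ t ∈ T, 0 < empiricalMean (Z · ω) n (f t) :=
    (T.eventually_all).2 fun t ht => (hω t ht).eventually_const_lt (hf_pos (hTC t ht))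
  filter_upwards [hT] with n hn s hs
  obtain ⟨t, ht, hst⟩ : ∃ t ∈ T, s ∈ Metric.ball t (δ t) := by simpa using hcover hs
  refine (hn t ht).trans_le (empiricalMean_mono (fun i => ?_) n)
  calc f t (Z i ω) ≤ F t (Z i ω) - L (Z i ω) * dist t s := by
        refine sub_le_sub_left ?_ _
        gcongr
        · exact le_abs_self _
        · rw [dist_comm]; exact hst.le
    _ ≤ F s (Z i ω) := by linarith [hω' i t (hTC t ht) s hs]

end ConvexConsistency

theorem isLittleO_integral_of_dominated {Ω E F : Type*} [MeasurableSpace Ω] {μ : Measure Ω}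
    [NormedAddCommGroup E] [NormedAddCommGroup F] [NormedSpace ℝ F] {R : E → Ω → F} {b : Ω → ℝ}
    {x₀ : E} (hR : ∀ x, AEStronglyMeasurable (R x) μ) (hb : Integrable b μ)
    (hbound : ∀ x, ∀ᵐ ω ∂μ, ‖R x ω‖ ≤ b ω * ‖x - x₀‖)
    (hlim : ∀ᵐ ω ∂μ, (fun x => R x ω) =o[𝓝 x₀] fun x => x - x₀) :
    (fun x => ∫ ω, R x ω ∂μ) =o[𝓝 x₀] fun x => x - x₀ := by
  have hscaled : Tendsto (fun x => ∫ ω, ‖x - x₀‖⁻¹ • R x ω ∂μ) (𝓝 x₀) (𝓝 (∫ _, 0 ∂μ)) := by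
    refine tendsto_integral_filter_of_dominated_convergence (fun ω => |b ω|)
      (Eventually.of_forall fun x => (hR x).const_smul _) (Eventually.of_forall fun x => ?_)
      hb.abs ?_
    · filter_upwards [hbound x] with ω hω
      rw [norm_smul, norm_inv, norm_norm, inv_mul_eq_div]
      exact div_le_of_le_mul₀ (norm_nonneg _) (abs_nonneg _)
        (hω.trans (mul_le_mul_of_nonneg_right (le_abs_self _) (norm_nonneg _)))
    · filter_upwards [hlim] with ω hω
      exact hω.norm_right.tendsto_inv_smul_nhds_zero
  simp only [integral_smul, integral_zero] at hscaled
  refine .of_norm_norm ((Asymptotics.isLittleO_iff_tendsto fun x hx => ?_).2 ?_)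
  · rw [sub_eq_zero.1 (norm_eq_zero.1 hx), norm_eq_zero]
    refine integral_eq_zero_of_ae ?_
    filter_upwards [hbound x₀] with ω hω
    simpa using hω
  · simpa only [norm_smul, norm_inv, norm_norm, inv_mul_eq_div, norm_zero] using hscaled.norm

section ScalarLoss

variable {y₁ y₂ : ℝ}

@[fun_prop]
theorem measurable_ind {β : Type*} [MeasurableSpace β] {p : β → Prop} [∀ b, Decidable (p b)]
    (h : MeasurableSet {b | p b}) : Measurable fun b => ind (p b) :=
  Measurable.ite h measurable_const measurable_const

theorem tlsScore_eq_clamp (t : ℝ) (h₁ : 0 ≤ y₁) (h₂ : 0 ≤ y₂) :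
    tlsScore t y₁ y₂ = max (-y₁) (min y₂ (y₂ - y₁ + t)) := by
  grind [tlsScore]

theorem abs_tlsScore_sub_le (t s : ℝ) (h₁ : 0 ≤ y₁) (h₂ : 0 ≤ y₂) :
    |tlsScore t y₁ y₂ - tlsScore s y₁ y₂| ≤ |t - s| := by
  rw [tlsScore_eq_clamp t h₁ h₂, tlsScore_eq_clamp s h₁ h₂]
  grind

theorem tlsLoss_tangent_le (t s : ℝ) (h₁ : 0 ≤ y₁) (h₂ : 0 ≤ y₂) :
    tlsLoss s y₁ y₂ + tlsScore s y₁ y₂ * (t - s) ≤ tlsLoss t y₁ y₂ := by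
  unfold tlsLoss tlsScore
  split_ifs <;> nlinarith [sq_nonneg (t - s), sq_nonneg (t + y₂), sq_nonneg (t - y₁),
    sq_nonneg (s + y₂), sq_nonneg (s - y₁)]

theorem convexOn_tlsLoss (h₁ : 0 ≤ y₁) (h₂ : 0 ≤ y₂) :
    ConvexOn ℝ Set.univ fun t => tlsLoss t y₁ y₂ := by
  have hmono : Monotone fun t => tlsScore t y₁ y₂ := fun s t hst => by
    simp only [tlsScore_eq_clamp _ h₁ h₂]
    gcongr
  have hderiv (t : ℝ) := hasDerivAt_tlsLoss t h₁ h₂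
  refine Monotone.convexOn_univ_of_deriv (fun t => (hderiv t).differentiableAt) ?_
  rwa [funext fun t => (hderiv t).deriv]

/-- The difference quotient of the score between `t₀` and a nearby `t`. At `t₀ = 0` it depends on
the side of `t`, as the two thresholds `y₁` and `-y₂` of the score may both be there. -/
noncomputable def tlsSlope (t₀ t y₁ y₂ : ℝ) : ℝ :=
  if 0 < t₀ then ind (t₀ < y₁)
  else if t₀ < 0 then ind (-y₂ < t₀)
  else if 0 < t then ind (0 < y₁) else ind (0 < y₂)

theorem tlsLoss_tangent_lt {t s : ℝ} (h₁ : 0 ≤ y₁) (h₂ : 0 ≤ y₂) (hslope : tlsSlope s t y₁ y₂ ≠ 0)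
    (hne : t ≠ s) : tlsLoss s y₁ y₂ + tlsScore s y₁ y₂ * (t - s) < tlsLoss t y₁ y₂ := by
  obtain ⟨u, hu⟩ : ∃ u, 0 < (tlsScore u y₁ y₂ - tlsScore s y₁ y₂) * (t - u) := by
    rcases lt_or_gt_of_ne hne with hlt | hlt
    · have hs : -y₂ < s ∧ s ≤ y₁ := by grind [tlsSlope, ind]
      have hu : max t (-y₂) < s := max_lt hlt hs.1
      refine ⟨(max t (-y₂) + s) / 2, mul_pos_of_neg_of_neg ?_ ?_⟩ <;> grind [tlsScore]
    · have hs : -y₂ ≤ s ∧ s < y₁ := by grind [tlsSlope, ind]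
      have hu : s < min t y₁ := lt_min hlt hs.2
      refine ⟨(min t y₁ + s) / 2, mul_pos ?_ ?_⟩ <;> grind [tlsScore]
  linarith [tlsLoss_tangent_le u s h₁ h₂, tlsLoss_tangent_le t u h₁ h₂]

theorem eventually_tlsScore_sub_eq {t₀ : ℝ} (h₁ : 0 ≤ y₁) (h₂ : 0 ≤ y₂)
    (hpos : 0 < t₀ → y₁ ≠ t₀) (hneg : t₀ < 0 → y₂ ≠ -t₀) :
    ∀ᶠ t in 𝓝 t₀, tlsScore t y₁ y₂ - tlsScore t₀ y₁ y₂ = tlsSlope t₀ t y₁ y₂ * (t - t₀) := by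
  rcases lt_trichotomy t₀ 0 with h₀ | rfl | h₀
  · rcases lt_or_gt_of_ne (hneg h₀) with h | h
    · filter_upwards [gt_mem_nhds (show t₀ < -y₂ by linarith)] with t ht
      grind [tlsScore, tlsSlope, ind]
    · filter_upwards [gt_mem_nhds h₀, lt_mem_nhds (show -y₂ < t₀ by linarith)] with t ht ht'
      grind [tlsScore, tlsSlope, ind]
  · have hy₁ : ∀ᶠ t in 𝓝 (0 : ℝ), 0 < y₁ → t < y₁ :=
      eventually_imp_distrib_left.2 fun h => gt_mem_nhds h
    have hy₂ : ∀ᶠ t in 𝓝 (0 : ℝ), 0 < y₂ → -y₂ < t :=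
      eventually_imp_distrib_left.2 fun h => lt_mem_nhds (by linarith)
    filter_upwards [hy₁, hy₂] with t ht ht'
    grind [tlsScore, tlsSlope, ind]
  · rcases lt_or_gt_of_ne (hpos h₀) with h | h
    · filter_upwards [lt_mem_nhds h] with t ht
      grind [tlsScore, tlsSlope, ind]
    · filter_upwards [lt_mem_nhds h₀, gt_mem_nhds h] with t ht ht'
      grind [tlsScore, tlsSlope, ind]

end ScalarLoss

namespace PanelObs

variable {K : ℕ} {z : PanelObs K}

/-- The difference quotient `tlsSlope` of the score of an observation, along the segment from `θ₀`
to `θ`. -/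
noncomputable def slopeWeight (z : PanelObs K) (θ₀ θ : RVec K) : ℝ :=
  tlsSlope (index z θ₀) (index z θ) (y₁ z) (y₂ z)

/-- The weight `𝟏{y₁ > 0} 𝟏{Δxᵀθ ≤ 0} + 𝟏{y₂ > 0} 𝟏{Δxᵀθ > 0}` of the Jacobian rank condition. -/
noncomputable def leftWeight (z : PanelObs K) (θ : RVec K) : ℝ :=
  ind (0 < y₁ z) * ind (index z θ ≤ 0) + ind (0 < y₂ z) * ind (0 < index z θ)

@[fun_prop]
theorem measurable_y₁ : Measurable (y₁ : PanelObs K → ℝ) := measurable_fst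

@[fun_prop]
theorem measurable_y₂ : Measurable (y₂ : PanelObs K → ℝ) := measurable_snd.snd.fst

@[fun_prop]
theorem measurable_dx : Measurable (dx : PanelObs K → RVec K) :=
  measurable_snd.fst.sub measurable_snd.snd.snd

@[fun_prop]
theorem measurable_index (θ : RVec K) : Measurable fun z : PanelObs K => index z θ :=
  measurable_dx.inner_const

@[fun_prop]
theorem measurable_score (θ : RVec K) : Measurable fun z : PanelObs K => score z θ :=
  Measurable.ite (measurableSet_le (by fun_prop) (by fun_prop)) (by fun_prop)
    (Measurable.ite (measurableSet_lt (by fun_prop) (by fun_prop)) (by fun_prop) (by fun_prop))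

@[fun_prop]
theorem measurable_loss (θ : RVec K) : Measurable fun z : PanelObs K => loss z θ :=
  .const_mul (.ite (measurableSet_le (by fun_prop) (by fun_prop)) (by fun_prop)
    (.ite (measurableSet_lt (by fun_prop) (by fun_prop)) (by fun_prop) (by fun_prop))) _

@[fun_prop]
theorem measurable_midWeight (θ : RVec K) : Measurable fun z : PanelObs K => midWeight z θ := by
  unfold midWeight
  fun_prop (disch := measurability)

@[fun_prop]
theorem measurable_leftWeight (θ : RVec K) : Measurable fun z : PanelObs K => leftWeight z θ := by
  unfold leftWeight
  fun_prop (disch := measurability)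

@[fun_prop]
theorem measurable_slopeWeight (θ₀ θ : RVec K) :
    Measurable fun z : PanelObs K => slopeWeight z θ₀ θ := by
  have hind {p : PanelObs K → Prop} [∀ z, Decidable (p z)] (hp : MeasurableSet {z | p z}) :
      Measurable fun z => ind (p z) := measurable_ind hp
  exact .ite (measurableSet_lt (by fun_prop) (by fun_prop))
    (hind (measurableSet_lt (by fun_prop) (by fun_prop)))
    (.ite (measurableSet_lt (by fun_prop) (by fun_prop))
      (hind (measurableSet_lt (by fun_prop) (by fun_prop)))
      (.ite (measurableSet_lt (by fun_prop) (by fun_prop))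
        (hind (measurableSet_lt (by fun_prop) (by fun_prop)))
        (hind (measurableSet_lt (by fun_prop) (by fun_prop)))))

theorem slopeWeight_mem_Icc (z : PanelObs K) (θ₀ θ : RVec K) :
    slopeWeight z θ₀ θ ∈ Set.Icc 0 1 := by
  grind [slopeWeight, tlsSlope, ind]

theorem midWeight_mem_Icc (z : PanelObs K) (θ : RVec K) : midWeight z θ ∈ Set.Icc 0 1 := by
  unfold midWeight ind
  constructor <;> split_ifs <;> linarith

theorem leftWeight_mem_Icc (z : PanelObs K) (θ : RVec K) : leftWeight z θ ∈ Set.Icc 0 1 := by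
  grind [leftWeight, ind]

theorem index_sub (z : PanelObs K) (θ θ' : RVec K) :
    index z (θ - θ') = index z θ - index z θ' := inner_sub_right _ _ _

theorem abs_index_le (z : PanelObs K) (θ : RVec K) : |index z θ| ≤ ‖dx z‖ * ‖θ‖ :=
  abs_real_inner_le_norm _ _

theorem abs_score_sub_le (h₁ : 0 ≤ y₁ z) (h₂ : 0 ≤ y₂ z) (θ θ' : RVec K) :
    |score z θ - score z θ'| ≤ ‖dx z‖ * ‖θ - θ'‖ := by
  refine (abs_tlsScore_sub_le _ _ h₁ h₂).trans ?_
  rw [← index_sub]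
  exact abs_index_le z _

theorem score_mul_index_le_loss_sub (h₁ : 0 ≤ y₁ z) (h₂ : 0 ≤ y₂ z) (θ θ' : RVec K) :
    score z θ * index z (θ' - θ) ≤ loss z θ' - loss z θ := by
  rw [index_sub]
  exact le_sub_iff_add_le'.2 (tlsLoss_tangent_le (index z θ') (index z θ) h₁ h₂)

theorem score_mul_index_lt_loss_sub (h₁ : 0 ≤ y₁ z) (h₂ : 0 ≤ y₂ z) {θ₀ θ : RVec K}
    (hslope : slopeWeight z θ₀ θ ≠ 0) (hne : index z (θ - θ₀) ≠ 0) :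
    score z θ₀ * index z (θ - θ₀) < loss z θ - loss z θ₀ := by
  rw [index_sub] at hne ⊢
  exact lt_sub_iff_add_lt'.2 (tlsLoss_tangent_lt h₁ h₂ hslope (sub_ne_zero.1 hne))

theorem convexOn_loss (h₁ : 0 ≤ y₁ z) (h₂ : 0 ≤ y₂ z) : ConvexOn ℝ Set.univ (loss z) :=
  (convexOn_tlsLoss h₁ h₂).comp_linearMap (innerₛₗ ℝ (dx z))

theorem eventually_score_sub_eq (h₁ : 0 ≤ y₁ z) (h₂ : 0 ≤ y₂ z) {θ₀ : RVec K}
    (hpos : 0 < index z θ₀ → y₁ z ≠ index z θ₀) (hneg : index z θ₀ < 0 → y₂ z ≠ -index z θ₀) :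
    ∀ᶠ θ in 𝓝 θ₀, score z θ - score z θ₀ = slopeWeight z θ₀ θ * index z (θ - θ₀) := by
  have hcont : Continuous (index z) := continuous_const.inner continuous_id
  filter_upwards [hcont.continuousAt.eventually (eventually_tlsScore_sub_eq h₁ h₂ hpos hneg)]
    with θ hθ
  rw [index_sub]
  exact hθ

/-- The observation generated by the censored regression model with parameter `θ₀` from
`w = (x₁, x₂, α)` and the errors `e = (ε₁, ε₂)`. -/
noncomputable def ofErrors (θ₀ : RVec K) (w : RVec K × RVec K × ℝ) (e : ℝ × ℝ) : PanelObs K :=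
  (max 0 (w.2.2 + inner ℝ w.1 θ₀ + e.1), w.1, max 0 (w.2.2 + inner ℝ w.2.1 θ₀ + e.2), w.2.1)

@[fun_prop]
theorem measurable_ofErrors (θ₀ : RVec K) :
    Measurable fun q : (RVec K × RVec K × ℝ) × ℝ × ℝ => ofErrors θ₀ q.1 q.2 := by
  unfold ofErrors
  fun_prop

section Exchange

variable (θ₀ : RVec K) (w : RVec K × RVec K × ℝ) (e : ℝ × ℝ)

theorem dx_ofErrors : dx (ofErrors θ₀ w e) = w.1 - w.2.1 := rfl

theorem index_ofErrors (θ : RVec K) : index (ofErrors θ₀ w e) θ = inner ℝ (w.1 - w.2.1) θ := rfl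

theorem y₁_ofErrors : y₁ (ofErrors θ₀ w e) = max 0 (w.2.2 + inner ℝ w.1 θ₀ + e.1) := rfl

theorem y₂_ofErrors : y₂ (ofErrors θ₀ w e) = max 0 (w.2.2 + inner ℝ w.2.1 θ₀ + e.2) := rfl

theorem score_ofErrors_add_swap :
    score (ofErrors θ₀ w e) θ₀ + score (ofErrors θ₀ w e.swap) θ₀ = 0 := by
  have hscore (a b u v : ℝ) : tlsScore (a - b) (max 0 (w.2.2 + a + u)) (max 0 (w.2.2 + b + v)) =
      max v (max (-w.2.2 - a) (-w.2.2 - b)) - max u (max (-w.2.2 - a) (-w.2.2 - b)) := by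
    rw [tlsScore_eq_clamp _ (le_max_left 0 _) (le_max_left 0 _)]
    grind
  simp only [score, index_ofErrors, inner_sub_left, y₁_ofErrors, y₂_ofErrors, hscore,
    Prod.fst_swap, Prod.snd_swap]
  ring

theorem leftWeight_ofErrors_add_swap :
    leftWeight (ofErrors θ₀ w e) θ₀ + leftWeight (ofErrors θ₀ w e.swap) θ₀ =
      midWeight (ofErrors θ₀ w e) θ₀ + midWeight (ofErrors θ₀ w e.swap) θ₀ := by
  simp only [leftWeight, midWeight, index_ofErrors, inner_sub_left, y₁_ofErrors, y₂_ofErrors,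
    Prod.fst_swap, Prod.snd_swap, lt_max_iff, lt_irrefl, false_or]
  generalize (inner ℝ w.1 θ₀ : ℝ) = a
  generalize (inner ℝ w.2.1 θ₀ : ℝ) = b
  rcases lt_trichotomy (a - b) 0 with h | h | h <;> grind [ind]

theorem slopeWeight_ofErrors_add_swap (θ : RVec K) :
    slopeWeight (ofErrors θ₀ w e) θ₀ θ + slopeWeight (ofErrors θ₀ w e.swap) θ₀ θ =
      midWeight (ofErrors θ₀ w e) θ₀ + midWeight (ofErrors θ₀ w e.swap) θ₀ := by
  simp only [slopeWeight, midWeight, tlsSlope, index_ofErrors, inner_sub_left, y₁_ofErrors,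
    y₂_ofErrors, Prod.fst_swap, Prod.snd_swap, lt_max_iff, lt_irrefl, false_or]
  generalize (inner ℝ w.1 θ₀ : ℝ) = a
  generalize (inner ℝ w.2.1 θ₀ : ℝ) = b
  rcases lt_trichotomy (a - b) 0 with h | h | h <;> grind [ind]

end Exchange

end PanelObs

namespace CensoredPanel

variable {K : ℕ} {Ω : Type*} [MeasurableSpace Ω] {M : CensoredPanel K Ω} {P : Measure Ω}

section Measurability

variable (M)

@[fun_prop]
theorem measurable_W : Measurable M.W :=
  M.measurable_X₁.prodMk (M.measurable_X₂.prodMk M.measurable_α)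

@[fun_prop]
theorem measurable_ε : Measurable M.ε := M.measurable_ε₁.prodMk M.measurable_ε₂

@[fun_prop]
theorem measurable_dX : Measurable M.dX := M.measurable_X₁.sub M.measurable_X₂

theorem obs_eq_ofErrors (ω : Ω) : M.obs ω = PanelObs.ofErrors M.θ₀ (M.W ω) (M.ε ω) := rfl

@[fun_prop]
theorem measurable_obs : Measurable M.obs :=
  (PanelObs.measurable_ofErrors M.θ₀).comp (M.measurable_W.prodMk M.measurable_ε)

theorem y₁_obs_nonneg (ω : Ω) : 0 ≤ (M.obs ω).y₁ := le_max_left _ _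

theorem y₂_obs_nonneg (ω : Ω) : 0 ≤ (M.obs ω).y₂ := le_max_left _ _

end Measurability

section Exchangeable

variable [IsFiniteMeasure P]

theorem identDistrib_swap (h : M.ExchangeableErrors P) :
    IdentDistrib (fun ω => (M.W ω, M.ε ω)) (fun ω => (M.W ω, (M.ε ω).swap)) P P := by
  have hswap : Measurable (Prod.map id Prod.swap : (RVec K × RVec K × ℝ) × ℝ × ℝ → _) :=
    measurable_id.prodMap measurable_swap
  have hjoint : (P.map M.W) ⊗ₘ condDistrib M.ε M.W P = P.map fun ω => (M.W ω, M.ε ω) :=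
    compProd_map_condDistrib (mβ := inferInstance) M.measurable_ε.aemeasurable
  refine ⟨by fun_prop,
    (M.measurable_W.prodMk (measurable_swap.comp M.measurable_ε)).aemeasurable, ?_⟩
  have hmap : P.map (fun ω => (M.W ω, (M.ε ω).swap)) =
      (P.map fun ω => (M.W ω, M.ε ω)).map (Prod.map id Prod.swap) :=
    (Measure.map_map hswap (M.measurable_W.prodMk M.measurable_ε)).symm
  rw [hmap, ← hjoint]
  ext s hs
  rw [Measure.map_apply hswap hs, Measure.compProd_apply hs, Measure.compProd_apply (hswap hs)]
  refine lintegral_congr_ae ?_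
  filter_upwards [h] with w hw
  nth_rewrite 1 [← hw]
  exact Measure.map_apply measurable_swap (measurable_prodMk_left hs)

theorem integral_obs_eq_of_symm {F : Type*} [NormedAddCommGroup F] [NormedSpace ℝ F]
    [MeasurableSpace F] [BorelSpace F] (h : M.ExchangeableErrors P) {f g : PanelObs K → F}
    (hf : Measurable f) (hg : Measurable g) (hfi : Integrable (fun ω => f (M.obs ω)) P)
    (hgi : Integrable (fun ω => g (M.obs ω)) P)
    (hfg : ∀ w e, f (.ofErrors M.θ₀ w e) + f (.ofErrors M.θ₀ w e.swap) =
      g (.ofErrors M.θ₀ w e) + g (.ofErrors M.θ₀ w e.swap)) :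
    ∫ ω, f (M.obs ω) ∂P = ∫ ω, g (M.obs ω) ∂P := by
  have hid : IdentDistrib M.obs (fun ω => .ofErrors M.θ₀ (M.W ω) (M.ε ω).swap) P P :=
    (identDistrib_swap h).comp (PanelObs.measurable_ofErrors M.θ₀)
  have htwo {u : PanelObs K → F} (hu : Measurable u) (hui : Integrable (fun ω => u (M.obs ω)) P) :
      (2 : ℝ) • ∫ ω, u (M.obs ω) ∂P =
        ∫ ω, u (M.obs ω) + u (.ofErrors M.θ₀ (M.W ω) (M.ε ω).swap) ∂P := by
    have hid' : IdentDistrib (fun ω => u (M.obs ω))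
        (fun ω => u (.ofErrors M.θ₀ (M.W ω) (M.ε ω).swap)) P P := hid.comp hu
    rw [integral_add hui (hid'.integrable_iff.1 hui), two_smul]
    exact congrArg (_ + ·) hid'.integral_eq
  refine smul_right_injective F (two_ne_zero (α := ℝ)) ?_
  change (2 : ℝ) • _ = (2 : ℝ) • _
  rw [htwo hf hfi, htwo hg hgi]
  exact integral_congr_ae (.of_forall fun ω => hfg (M.W ω) (M.ε ω))

end Exchangeable

section Continuous

variable [IsFiniteMeasure P]

theorem ae_W_ε_notMem (h : M.ContinuousErrors P) {s : Set ((RVec K × RVec K × ℝ) × ℝ × ℝ)}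
    (hs : MeasurableSet s) (h₀ : ∀ w, (volume : Measure (ℝ × ℝ)) (Prod.mk w ⁻¹' s) = 0) :
    ∀ᵐ ω ∂P, (M.W ω, M.ε ω) ∉ s := by
  have hjoint : (P.map M.W) ⊗ₘ condDistrib M.ε M.W P = P.map fun ω => (M.W ω, M.ε ω) :=
    compProd_map_condDistrib (mβ := inferInstance) M.measurable_ε.aemeasurable
  have hzero : (P.map fun ω => (M.W ω, M.ε ω)) s = 0 := by
    rw [← hjoint, Measure.compProd_apply hs]
    refine lintegral_eq_zero_of_ae_eq_zero ?_
    filter_upwards [h] with w hw using hw (h₀ w)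
  rw [Measure.map_apply (by fun_prop) hs] at hzero
  exact measure_eq_zero_iff_ae_notMem.1 hzero

theorem ae_fst_ε_ne (h : M.ContinuousErrors P) {g : RVec K × RVec K × ℝ → ℝ} (hg : Measurable g) :
    ∀ᵐ ω ∂P, (M.ε ω).1 ≠ g (M.W ω) := by
  refine ae_W_ε_notMem h (s := {q | q.2.1 = g q.1})
    (measurableSet_eq_fun measurable_snd.fst (hg.comp measurable_fst)) fun w => ?_
  have hsection : Prod.mk w ⁻¹' {q : (RVec K × RVec K × ℝ) × ℝ × ℝ | q.2.1 = g q.1} =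
      {g w} ×ˢ Set.univ := by ext; simp
  rw [hsection, Measure.volume_eq_prod, Measure.prod_prod, Real.volume_singleton, zero_mul]

theorem ae_snd_ε_ne (h : M.ContinuousErrors P) {g : RVec K × RVec K × ℝ → ℝ} (hg : Measurable g) :
    ∀ᵐ ω ∂P, (M.ε ω).2 ≠ g (M.W ω) := by
  refine ae_W_ε_notMem h (s := {q | q.2.2 = g q.1})
    (measurableSet_eq_fun measurable_snd.snd (hg.comp measurable_fst)) fun w => ?_
  have hsection : Prod.mk w ⁻¹' {q : (RVec K × RVec K × ℝ) × ℝ × ℝ | q.2.2 = g q.1} =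
      Set.univ ×ˢ {g w} := by ext; simp
  rw [hsection, Measure.volume_eq_prod, Measure.prod_prod, Real.volume_singleton, mul_zero]

/-- Positive `Δxᵀθ₀` meets the kink `y₁` only if `ε₁` equals `-α - x₂ᵀθ₀`, and negative `Δxᵀθ₀`
meets the kink `-y₂` only if `ε₂` equals `-α - x₁ᵀθ₀`. -/
theorem ae_eventually_score_sub_eq (h : M.ContinuousErrors P) :
    ∀ᵐ ω ∂P, ∀ᶠ θ in 𝓝 M.θ₀, (M.obs ω).score θ - (M.obs ω).score M.θ₀ =
      (M.obs ω).slopeWeight M.θ₀ θ * (M.obs ω).index (θ - M.θ₀) := by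
  filter_upwards [ae_fst_ε_ne h (g := fun w => -w.2.2 - inner ℝ w.2.1 M.θ₀) (by fun_prop),
    ae_snd_ε_ne h (g := fun w => -w.2.2 - inner ℝ w.1 M.θ₀) (by fun_prop)] with ω hε₁ hε₂
  refine PanelObs.eventually_score_sub_eq (M.y₁_obs_nonneg ω) (M.y₂_obs_nonneg ω) ?_ ?_
  · rw [obs_eq_ofErrors, PanelObs.index_ofErrors, inner_sub_left, PanelObs.y₁_ofErrors]
    intro h₀ hy
    obtain ⟨hy, -⟩ | ⟨hy, -⟩ := max_eq_iff.1 hy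
    · linarith
    · exact hε₁ (by linarith)
  · rw [obs_eq_ofErrors, PanelObs.index_ofErrors, inner_sub_left, PanelObs.y₂_ofErrors]
    intro h₀ hy
    obtain ⟨hy, -⟩ | ⟨hy, -⟩ := max_eq_iff.1 hy
    · linarith
    · exact hε₂ (by linarith)

end Continuous

end CensoredPanel

section Outer

variable {K : ℕ}

theorem abs_outer_le (v : RVec K) (j k : Fin K) : |outer v j k| ≤ 1 * ‖v‖ ^ 2 := by
  rw [one_mul, sq]
  exact (abs_mul _ _).trans_le (mul_le_mul (PiLp.norm_apply_le v j) (PiLp.norm_apply_le v k)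
    (abs_nonneg _) (norm_nonneg v))

@[fun_prop]
theorem continuous_outer_apply (j k : Fin K) : Continuous fun v : RVec K => outer v j k := by
  unfold outer
  simp only [Matrix.of_apply]
  fun_prop

end Outer

namespace CensoredPanel

variable {K : ℕ} {Ω : Type*} [MeasurableSpace Ω] {M : CensoredPanel K Ω} {P : Measure Ω}

theorem memLp_dX_four (h : M.MomentConditions P) : MemLp M.dX 4 P := by
  have hfour {X : Ω → RVec K} (hX : Measurable X) (hint : Integrable (fun ω => ‖X ω‖ ^ 4) P) :
      MemLp X 4 P :=
    (integrable_norm_rpow_iff hX.aestronglyMeasurable (by simp) (by simp)).1 (by simpa using hint)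
  exact (hfour M.measurable_X₁ h.1).sub (hfour M.measurable_X₂ h.2.1)

theorem memLp_score_smul (h : M.VExists P) :
    MemLp (fun ω => (M.obs ω).score M.θ₀ • M.dX ω) 2 P := by
  refine (memLp_two_iff_integrable_sq_norm (by fun_prop)).2 ?_
  refine (integrable_finsetSum Finset.univ fun j _ => h j j).congr (.of_forall fun ω => ?_)
  change ∑ j, _ * (M.dX ω j * M.dX ω j) = ‖_ • M.dX ω‖ ^ 2
  rw [norm_smul, mul_pow, EuclideanSpace.real_norm_sq_eq, Real.norm_eq_abs, sq_abs, Finset.mul_sum]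
  simp only [sq]

theorem integrable_score_smul (h2 : MemLp M.dX 2 P)
    (h₀ : Integrable (fun ω => (M.obs ω).score M.θ₀ • M.dX ω) P) (θ : RVec K) :
    Integrable (fun ω => (M.obs ω).score θ • M.dX ω) P := by
  have hdiff : Integrable
      (fun ω => ((M.obs ω).score θ - (M.obs ω).score M.θ₀) • M.dX ω) P := by
    refine ((h2.integrable_norm_pow two_ne_zero).mul_const ‖θ - M.θ₀‖).mono' (by fun_prop)
      (.of_forall fun ω => ?_)
    calc ‖((M.obs ω).score θ - (M.obs ω).score M.θ₀) • M.dX ω‖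
        ≤ ‖M.dX ω‖ * ‖θ - M.θ₀‖ * ‖M.dX ω‖ := by
          rw [norm_smul]
          gcongr
          exact PanelObs.abs_score_sub_le (M.y₁_obs_nonneg ω) (M.y₂_obs_nonneg ω) θ M.θ₀
      _ = ‖M.dX ω‖ ^ 2 * ‖θ - M.θ₀‖ := by ring
  refine (hdiff.add h₀).congr (.of_forall fun ω => ?_)
  simp only [Pi.add_apply, sub_smul, sub_add_cancel]

section Weight

variable {F : Type*} [NormedAddCommGroup F] [NormedSpace ℝ F] {w w' : PanelObs K → ℝ}
  {q : RVec K → F} {c : ℝ}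

theorem integrable_weight_smul (h2 : MemLp M.dX 2 P) (hw : Measurable w)
    (hw₁ : ∀ z, w z ∈ Set.Icc 0 1) (hq : Continuous q) (hqc : ∀ v, ‖q v‖ ≤ c * ‖v‖ ^ 2) :
    Integrable (fun ω => w (M.obs ω) • q (M.dX ω)) P := by
  refine ((h2.integrable_norm_pow two_ne_zero).const_mul c).mono'
    ((hw.comp M.measurable_obs).aestronglyMeasurable.smul
      (hq.comp_aestronglyMeasurable M.measurable_dX.aestronglyMeasurable)) (.of_forall fun ω => ?_)
  rw [norm_smul, Real.norm_of_nonneg (hw₁ _).1]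
  exact (mul_le_of_le_one_left (norm_nonneg _) (hw₁ _).2).trans (hqc _)

theorem integral_weight_smul_eq_of_symm [IsFiniteMeasure P] [MeasurableSpace F] [BorelSpace F]
    [SecondCountableTopology F] (h : M.ExchangeableErrors P) (h2 : MemLp M.dX 2 P)
    (hw : Measurable w) (hw₁ : ∀ z, w z ∈ Set.Icc 0 1)
    (hw' : Measurable w') (hw'₁ : ∀ z, w' z ∈ Set.Icc 0 1)
    (hsymm : ∀ x e, w (.ofErrors M.θ₀ x e) + w (.ofErrors M.θ₀ x e.swap) =
      w' (.ofErrors M.θ₀ x e) + w' (.ofErrors M.θ₀ x e.swap))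
    (hq : Continuous q) (hqc : ∀ v, ‖q v‖ ≤ c * ‖v‖ ^ 2) :
    ∫ ω, w (M.obs ω) • q (M.dX ω) ∂P = ∫ ω, w' (M.obs ω) • q (M.dX ω) ∂P := by
  have hqdx : Measurable fun z : PanelObs K => q z.dx :=
    hq.measurable.comp PanelObs.measurable_dx
  refine integral_obs_eq_of_symm (f := fun z => w z • q z.dx) (g := fun z => w' z • q z.dx) h
    (hw.smul hqdx) (hw'.smul hqdx) (integrable_weight_smul h2 hw hw₁ hq hqc)
    (integrable_weight_smul h2 hw' hw'₁ hq hqc) fun x e => ?_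
  simp only [PanelObs.dx_ofErrors, ← add_smul, hsymm]

end Weight

end CensoredPanel

section InnerSelf

variable {E : Type*} [NormedAddCommGroup E] [InnerProductSpace ℝ E]

theorem norm_inner_smul_self_le (u v : E) : ‖inner ℝ v u • v‖ ≤ ‖u‖ * ‖v‖ ^ 2 := by
  rw [norm_smul]
  calc ‖inner ℝ v u‖ * ‖v‖ ≤ ‖v‖ * ‖u‖ * ‖v‖ := by gcongr; exact norm_inner_le_norm v u
    _ = ‖u‖ * ‖v‖ ^ 2 := by ring

theorem norm_inner_sq_le (u v : E) : ‖(inner ℝ v u : ℝ) ^ 2‖ ≤ ‖u‖ ^ 2 * ‖v‖ ^ 2 := by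
  rw [norm_pow, mul_comm, ← mul_pow]
  exact pow_le_pow_left₀ (norm_nonneg _) (norm_inner_le_norm v u) 2

end InnerSelf

namespace CensoredPanel

variable {K : ℕ} {Ω : Type*} [MeasurableSpace Ω] {M : CensoredPanel K Ω} {P : Measure Ω}

/-- The operator `E[w ΔX ΔXᵀ]` with `w` the midpoint weight at `θ₀`; by `hasFDerivAt_G` it is the
derivative of the expected score there. -/
noncomputable def scoreDeriv (M : CensoredPanel K Ω) (P : Measure Ω) : RVec K →L[ℝ] RVec K :=
  ∫ ω, (M.obs ω).midWeight M.θ₀ • InnerProductSpace.rankOne ℝ (M.dX ω) (M.dX ω) ∂P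

theorem integrable_midWeight_inner_smul (h2 : MemLp M.dX 2 P) (u : RVec K) :
    Integrable (fun ω => (M.obs ω).midWeight M.θ₀ • inner ℝ (M.dX ω) u • M.dX ω) P :=
  integrable_weight_smul h2 (PanelObs.measurable_midWeight M.θ₀)
    (PanelObs.midWeight_mem_Icc · M.θ₀) (by fun_prop) (norm_inner_smul_self_le u)

theorem scoreDeriv_apply (h2 : MemLp M.dX 2 P) (u : RVec K) :
    M.scoreDeriv P u = ∫ ω, (M.obs ω).midWeight M.θ₀ • inner ℝ (M.dX ω) u • M.dX ω ∂P := by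
  refine ContinuousLinearMap.integral_apply ?_ u
  refine integrable_weight_smul (q := fun v => InnerProductSpace.rankOne ℝ v v) (c := 1) h2
    (PanelObs.measurable_midWeight M.θ₀) (PanelObs.midWeight_mem_Icc · M.θ₀)
    ((InnerProductSpace.rankOne ℝ).continuous.clm_apply continuous_id) fun v => ?_
  rw [InnerProductSpace.norm_rankOne, one_mul, sq]

variable [IsFiniteMeasure P]

theorem integral_slopeWeight_eq_scoreDeriv (he : M.ExchangeableErrors P) (h2 : MemLp M.dX 2 P)
    (θ u : RVec K) :
    ∫ ω, (M.obs ω).slopeWeight M.θ₀ θ • inner ℝ (M.dX ω) u • M.dX ω ∂P = M.scoreDeriv P u := by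
  rw [scoreDeriv_apply h2]
  exact integral_weight_smul_eq_of_symm he h2 (PanelObs.measurable_slopeWeight M.θ₀ θ)
    (PanelObs.slopeWeight_mem_Icc · M.θ₀ θ) (PanelObs.measurable_midWeight M.θ₀)
    (PanelObs.midWeight_mem_Icc · M.θ₀)
    (fun x e => PanelObs.slopeWeight_ofErrors_add_swap M.θ₀ x e θ) (by fun_prop)
    (norm_inner_smul_self_le u)

theorem hasFDerivAt_G (hc : M.ContinuousErrors P) (he : M.ExchangeableErrors P)
    (h2 : MemLp M.dX 2 P) (h₀ : Integrable (fun ω => (M.obs ω).score M.θ₀ • M.dX ω) P) :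
    HasFDerivAt (M.G P) (M.scoreDeriv P) M.θ₀ := by
  have hscore := integrable_score_smul h2 h₀
  have hslope (θ : RVec K) := integrable_weight_smul h2 (PanelObs.measurable_slopeWeight M.θ₀ θ)
    (PanelObs.slopeWeight_mem_Icc · M.θ₀ θ) (by fun_prop) (norm_inner_smul_self_le (θ - M.θ₀))
  have hremainder (θ : RVec K) : M.G P θ - M.G P M.θ₀ - M.scoreDeriv P (θ - M.θ₀) =
      ∫ ω, ((M.obs ω).score θ - (M.obs ω).score M.θ₀ -
        (M.obs ω).slopeWeight M.θ₀ θ * (M.obs ω).index (θ - M.θ₀)) • M.dX ω ∂P := by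
    rw [← integral_slopeWeight_eq_scoreDeriv he h2 θ, G, G, ← integral_sub (hscore θ) (hscore M.θ₀)]
    refine (integral_sub ((hscore θ).sub (hscore M.θ₀)) (hslope θ)).symm.trans
      (integral_congr_ae (.of_forall fun ω => ?_))
    simp only [sub_smul, mul_smul]
    rfl
  rw [hasFDerivAt_iff_isLittleO]
  simp only [hremainder]
  refine isLittleO_integral_of_dominated (b := fun ω => 2 * ‖M.dX ω‖ ^ 2) (by fun_prop)
    ((h2.integrable_norm_pow two_ne_zero).const_mul 2) (fun θ => .of_forall fun ω => ?_) ?_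
  · have hslope_le : |(M.obs ω).slopeWeight M.θ₀ θ * (M.obs ω).index (θ - M.θ₀)| ≤
        ‖M.dX ω‖ * ‖θ - M.θ₀‖ := by
      obtain ⟨hnonneg, hle⟩ := (M.obs ω).slopeWeight_mem_Icc M.θ₀ θ
      rw [abs_mul, abs_of_nonneg hnonneg]
      exact (mul_le_of_le_one_left (abs_nonneg _) hle).trans (PanelObs.abs_index_le _ _)
    have hscore_le := PanelObs.abs_score_sub_le (M.y₁_obs_nonneg ω) (M.y₂_obs_nonneg ω) θ M.θ₀
    rw [norm_smul]
    calc _ ≤ (‖M.dX ω‖ * ‖θ - M.θ₀‖ + ‖M.dX ω‖ * ‖θ - M.θ₀‖) * ‖M.dX ω‖ := by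
          gcongr
          exact (norm_sub_le _ _).trans (add_le_add hscore_le hslope_le)
      _ = 2 * ‖M.dX ω‖ ^ 2 * ‖θ - M.θ₀‖ := by ring
  · filter_upwards [ae_eventually_score_sub_eq hc] with ω hω
    refine (Asymptotics.isLittleO_zero _ _).congr' ?_ .rfl
    filter_upwards [hω] with θ hθ
    rw [hθ, sub_self, zero_smul]

theorem J₀_apply (hc : M.ContinuousErrors P) (he : M.ExchangeableErrors P)
    (h2 : MemLp M.dX 2 P) (h₀ : Integrable (fun ω => (M.obs ω).score M.θ₀ • M.dX ω) P)
    (j k : Fin K) :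
    M.J₀ P j k = ∫ ω, (M.obs ω).midWeight M.θ₀ * outer (M.dX ω) j k ∂P := by
  change fderiv ℝ (M.G P) M.θ₀ (EuclideanSpace.single k 1) j = _
  rw [(hasFDerivAt_G hc he h2 h₀).fderiv, scoreDeriv_apply h2]
  refine ((EuclideanSpace.proj (𝕜 := ℝ) j).integral_comp_comm
    (integrable_midWeight_inner_smul h2 _)).symm.trans (integral_congr_ae (.of_forall fun ω => ?_))
  simp [outer, EuclideanSpace.inner_single_right, mul_comm]

theorem J₀_eq_toMatrix (hc : M.ContinuousErrors P) (he : M.ExchangeableErrors P)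
    (h2 : MemLp M.dX 2 P) (h₀ : Integrable (fun ω => (M.obs ω).score M.θ₀ • M.dX ω) P) :
    M.J₀ P = LinearMap.toMatrix (EuclideanSpace.basisFun (Fin K) ℝ).toBasis
      (EuclideanSpace.basisFun (Fin K) ℝ).toBasis (M.scoreDeriv P).toLinearMap := by
  ext j k
  simp [J₀, LinearMap.toMatrix_apply, (hasFDerivAt_G hc he h2 h₀).fderiv]

theorem inner_scoreDeriv_self (he : M.ExchangeableErrors P) (h2 : MemLp M.dX 2 P) (v : RVec K) :
    inner ℝ v (M.scoreDeriv P v) =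
      ∫ ω, (M.obs ω).leftWeight M.θ₀ * inner ℝ (M.dX ω) v ^ 2 ∂P := by
  calc inner ℝ v (M.scoreDeriv P v)
      = ∫ ω, (M.obs ω).midWeight M.θ₀ • inner ℝ (M.dX ω) v ^ 2 ∂P := by
        rw [scoreDeriv_apply h2, ← integral_inner (integrable_midWeight_inner_smul h2 v)]
        refine integral_congr_ae (.of_forall fun ω => ?_)
        simp only [real_inner_smul_right, real_inner_comm v, smul_eq_mul, sq]
    _ = ∫ ω, (M.obs ω).leftWeight M.θ₀ * inner ℝ (M.dX ω) v ^ 2 ∂P :=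
        (integral_weight_smul_eq_of_symm he h2 (PanelObs.measurable_leftWeight M.θ₀)
          (PanelObs.leftWeight_mem_Icc · M.θ₀) (PanelObs.measurable_midWeight M.θ₀)
          (PanelObs.midWeight_mem_Icc · M.θ₀) (PanelObs.leftWeight_ofErrors_add_swap M.θ₀)
          (by fun_prop) (norm_inner_sq_le v)).symm

theorem inner_scoreDeriv_self_pos (he : M.ExchangeableErrors P) (h2 : MemLp M.dX 2 P)
    (hj : M.JacobianRank P) {v : RVec K} (hv : v ≠ 0) : 0 < inner ℝ v (M.scoreDeriv P v) := by
  have hint : Integrable (fun ω => (M.obs ω).leftWeight M.θ₀ * inner ℝ (M.dX ω) v ^ 2) P :=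
    integrable_weight_smul h2 (PanelObs.measurable_leftWeight M.θ₀)
      (PanelObs.leftWeight_mem_Icc · M.θ₀) (by fun_prop) (norm_inner_sq_le v)
  have hnonneg (ω : Ω) : 0 ≤ (M.obs ω).leftWeight M.θ₀ * inner ℝ (M.dX ω) v ^ 2 :=
    mul_nonneg ((M.obs ω).leftWeight_mem_Icc M.θ₀).1 (sq_nonneg _)
  rw [inner_scoreDeriv_self he h2]
  refine (integral_nonneg hnonneg).lt_of_ne' fun hzero => hv ?_
  have htop : (ℝ ∙ v)ᗮ = ⊤ := by
    refine hj _ ?_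
    filter_upwards [(integral_eq_zero_iff_of_nonneg hnonneg hint).1 hzero] with ω hω
    change (M.obs ω).leftWeight M.θ₀ • M.dX ω ∈ _
    rw [Submodule.mem_orthogonal_singleton_iff_inner_left, real_inner_smul_left]
    obtain hweight | hinner := mul_eq_zero.1 hω
    · rw [hweight, zero_mul]
    · rw [pow_eq_zero_iff two_ne_zero |>.1 hinner, mul_zero]
  exact inner_self_eq_zero.1
    (Submodule.mem_orthogonal_singleton_iff_inner_left.1 (htop ▸ Submodule.mem_top))

theorem isUnit_det_J₀ (hc : M.ContinuousErrors P) (he : M.ExchangeableErrors P)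
    (h2 : MemLp M.dX 2 P) (h₀ : Integrable (fun ω => (M.obs ω).score M.θ₀ • M.dX ω) P)
    (hj : M.JacobianRank P) :
    IsUnit (M.J₀ P).det := by
  rw [J₀_eq_toMatrix hc he h2 h₀, LinearMap.det_toMatrix, ← LinearMap.isUnit_iff_isUnit_det,
    LinearMap.isUnit_iff_ker_eq_bot, LinearMap.ker_eq_bot']
  intro v hv
  by_contra hne
  refine (inner_scoreDeriv_self_pos he h2 hj hne).ne' ?_
  change inner ℝ v ((M.scoreDeriv P).toLinearMap v) = 0
  rw [hv, inner_zero_right]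

end CensoredPanel

namespace PanelObs

variable {K : ℕ} {z : PanelObs K}

theorem loss_sub_le_mul_dist (h₁ : 0 ≤ y₁ z) (h₂ : 0 ≤ y₂ z) (θ₀ θ θ' : RVec K) :
    loss z θ - loss z θ' ≤ (|score z θ₀| + ‖dx z‖ * ‖θ - θ₀‖) * ‖dx z‖ * dist θ θ' := by
  have hscore : |score z θ| ≤ |score z θ₀| + ‖dx z‖ * ‖θ - θ₀‖ := by
    have := abs_sub_abs_le_abs_sub (score z θ) (score z θ₀)
    linarith [abs_score_sub_le h₁ h₂ θ θ₀]
  have htangent := score_mul_index_le_loss_sub h₁ h₂ θ θ'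
  rw [← neg_sub θ θ', index, inner_neg_right, mul_neg, ← index] at htangent
  calc loss z θ - loss z θ' ≤ score z θ * index z (θ - θ') := by linarith
    _ ≤ |score z θ| * |index z (θ - θ')| := (le_abs_self _).trans_eq (abs_mul _ _)
    _ ≤ (|score z θ₀| + ‖dx z‖ * ‖θ - θ₀‖) * (‖dx z‖ * ‖θ - θ'‖) :=
        mul_le_mul hscore (abs_index_le z _) (abs_nonneg _) (by positivity)
    _ = (|score z θ₀| + ‖dx z‖ * ‖θ - θ₀‖) * ‖dx z‖ * dist θ θ' := by rw [dist_eq_norm, mul_assoc]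

end PanelObs

theorem convexOn_tlsCriterion {K : ℕ} {z : ℕ → PanelObs K}
    (hz : ∀ i, 0 ≤ (z i).y₁ ∧ 0 ≤ (z i).y₂) (n : ℕ) :
    ConvexOn ℝ Set.univ (tlsCriterion z n) := by
  have hsum : ConvexOn ℝ Set.univ (∑ i ∈ Finset.range n, (z i).loss) :=
    Finset.sum_induction _ (ConvexOn ℝ Set.univ) (fun _ _ => ConvexOn.add)
      (convexOn_const 0 convex_univ) fun i _ => PanelObs.convexOn_loss (hz i).1 (hz i).2
  refine (hsum.smul (by positivity : (0 : ℝ) ≤ (n : ℝ)⁻¹)).congr fun θ _ => ?_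
  simp only [tlsCriterion, Finset.sum_apply, smul_eq_mul]

theorem tlsCriterion_sub {K : ℕ} (z : ℕ → PanelObs K) (n : ℕ) (θ θ' : RVec K) :
    tlsCriterion z n θ - tlsCriterion z n θ' = empiricalMean z n fun x => x.loss θ - x.loss θ' :=
  (empiricalMean_sub z n (·.loss θ) (·.loss θ')).symm

namespace CensoredPanel

variable {K : ℕ} {Ω Ω' : Type*} [MeasurableSpace Ω] [MeasurableSpace Ω'] {M : CensoredPanel K Ω}
  {P : Measure Ω} {Q : Measure Ω'} {Z : ℕ → Ω' → PanelObs K}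

theorem integrable_score_mul_index {θ : RVec K}
    (h : Integrable (fun ω => (M.obs ω).score θ • M.dX ω) P) (u : RVec K) :
    Integrable (fun ω => (M.obs ω).score θ * (M.obs ω).index u) P :=
  (h.inner_const u).congr (.of_forall fun _ => real_inner_smul_left _ _ _)

theorem integrable_loss_sub (h2 : MemLp M.dX 2 P)
    (h₀ : Integrable (fun ω => (M.obs ω).score M.θ₀ • M.dX ω) P) (θ : RVec K) :
    Integrable (fun ω => (M.obs ω).loss θ - (M.obs ω).loss M.θ₀) P := by
  have h₁ := M.y₁_obs_nonneg
  have h₂ := M.y₂_obs_nonneg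
  refine integrable_of_le_of_le (by fun_prop)
    (.of_forall fun ω => PanelObs.score_mul_index_le_loss_sub (h₁ ω) (h₂ ω) M.θ₀ θ)
    (.of_forall fun ω => ?_) (integrable_score_mul_index h₀ (θ - M.θ₀))
    (integrable_score_mul_index (integrable_score_smul h2 h₀ θ) (θ - M.θ₀))
  have := PanelObs.score_mul_index_le_loss_sub (h₁ ω) (h₂ ω) θ M.θ₀
  rw [PanelObs.index_sub] at this ⊢
  linarith

theorem ae_sample_nonneg (hid : ∀ i, IdentDistrib (Z i) M.obs Q P) :
    ∀ᵐ ω ∂Q, ∀ i, 0 ≤ (Z i ω).y₁ ∧ 0 ≤ (Z i ω).y₂ :=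
  ae_all_iff.2 fun i => (hid i).symm.ae_snd (p := fun z : PanelObs K => 0 ≤ z.y₁ ∧ 0 ≤ z.y₂)
    ((measurableSet_le measurable_const PanelObs.measurable_y₁).inter
      (measurableSet_le measurable_const PanelObs.measurable_y₂))
    (.of_forall fun ω => ⟨M.y₁_obs_nonneg ω, M.y₂_obs_nonneg ω⟩)

variable [IsFiniteMeasure P]

theorem G_eq_zero (he : M.ExchangeableErrors P)
    (h₀ : Integrable (fun ω => (M.obs ω).score M.θ₀ • M.dX ω) P) : M.G P M.θ₀ = 0 := by
  have hsymm := integral_obs_eq_of_symm (f := fun z => z.score M.θ₀ • z.dx) (g := fun _ => 0) he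
    (by fun_prop) measurable_const h₀ (integrable_zero _ _ _) fun w e => by
      rw [PanelObs.dx_ofErrors, PanelObs.dx_ofErrors, ← add_smul,
        PanelObs.score_ofErrors_add_swap, zero_smul, add_zero]
  exact hsymm.trans (integral_zero _ _)

theorem integral_score_mul_index (he : M.ExchangeableErrors P)
    (h₀ : Integrable (fun ω => (M.obs ω).score M.θ₀ • M.dX ω) P) (u : RVec K) :
    ∫ ω, (M.obs ω).score M.θ₀ * (M.obs ω).index u ∂P = 0 := by
  rw [← inner_zero_right u, ← G_eq_zero he h₀, G, ← integral_inner h₀]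
  refine integral_congr_ae (.of_forall fun ω => ?_)
  change _ = inner ℝ u (_ • M.dX ω)
  rw [real_inner_smul_right, real_inner_comm]
  rfl

theorem integral_loss_sub_pos (he : M.ExchangeableErrors P) (h2 : MemLp M.dX 2 P)
    (h₀ : Integrable (fun ω => (M.obs ω).score M.θ₀ • M.dX ω) P) (hj : M.JacobianRank P)
    {θ : RVec K} (hθ : θ ≠ M.θ₀) :
    0 < ∫ ω, (M.obs ω).loss θ - (M.obs ω).loss M.θ₀ ∂P := by
  have hscore := integrable_score_mul_index h₀ (θ - M.θ₀)
  have hloss := integrable_loss_sub h2 h₀ θ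
  have hgap : 0 ≤ fun ω => (M.obs ω).loss θ - (M.obs ω).loss M.θ₀ -
      (M.obs ω).score M.θ₀ * (M.obs ω).index (θ - M.θ₀) := fun ω =>
    sub_nonneg.2 (PanelObs.score_mul_index_le_loss_sub (M.y₁_obs_nonneg ω) (M.y₂_obs_nonneg ω) _ _)
  have hgap_mean : ∫ ω, (M.obs ω).loss θ - (M.obs ω).loss M.θ₀ -
      (M.obs ω).score M.θ₀ * (M.obs ω).index (θ - M.θ₀) ∂P =
      ∫ ω, (M.obs ω).loss θ - (M.obs ω).loss M.θ₀ ∂P := by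
    rw [integral_sub hloss hscore, integral_score_mul_index he h₀, sub_zero]
  rw [← hgap_mean]
  refine (integral_nonneg hgap).lt_of_ne' fun hzero => ?_
  have hslope : M.scoreDeriv P (θ - M.θ₀) = 0 := by
    rw [← integral_slopeWeight_eq_scoreDeriv he h2 θ]
    refine integral_eq_zero_of_ae ?_
    filter_upwards [(integral_eq_zero_iff_of_nonneg hgap (hloss.sub hscore)).1 hzero] with ω hω
    by_contra hne
    obtain ⟨hweight, hne⟩ := smul_ne_zero_iff.1 hne
    exact (PanelObs.score_mul_index_lt_loss_sub (M.y₁_obs_nonneg ω) (M.y₂_obs_nonneg ω) hweight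
      (smul_ne_zero_iff.1 hne).1).ne' (sub_eq_zero.1 hω)
  have hpos := inner_scoreDeriv_self_pos he h2 hj (sub_ne_zero.2 hθ)
  rw [hslope, inner_zero_right] at hpos
  exact hpos.false

theorem ae_eventually_tlsCriterion_lt_on_sphere (he : M.ExchangeableErrors P)
    (h2 : MemLp M.dX 2 P) (h₀ : Integrable (fun ω => (M.obs ω).score M.θ₀ • M.dX ω) P)
    (hj : M.JacobianRank P) (hindep : Pairwise fun i j => IndepFun (Z i) (Z j) Q)
    (hid : ∀ i, IdentDistrib (Z i) M.obs Q P) {r : ℝ} (hr : 0 < r) :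
    ∀ᵐ ω ∂Q, ∀ᶠ n in atTop, ∀ θ ∈ Metric.sphere M.θ₀ r,
      tlsCriterion (Z · ω) n M.θ₀ < tlsCriterion (Z · ω) n θ := by
  have hLint : Integrable
      (fun ω => (|(M.obs ω).score M.θ₀| + ‖M.dX ω‖ * r) * ‖M.dX ω‖) P := by
    refine (h₀.norm.add ((h2.integrable_norm_pow two_ne_zero).mul_const r)).congr
      (.of_forall fun ω => ?_)
    simp only [Pi.add_apply, norm_smul, Real.norm_eq_abs]
    ring
  have hpos := ae_eventually_forall_empiricalMean_pos hindep hid (isCompact_sphere M.θ₀ r)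
    (F := fun θ z => z.loss θ - z.loss M.θ₀) (by fun_prop)
    (fun θ _ => integrable_loss_sub h2 h₀ θ)
    (fun θ hθ => integral_loss_sub_pos he h2 h₀ hj (Metric.ne_of_mem_sphere hθ hr.ne'))
    (L := fun z => (|z.score M.θ₀| + ‖z.dx‖ * r) * ‖z.dx‖) (by fun_prop) hLint ?_
  · filter_upwards [hpos] with ω hω
    filter_upwards [hω] with n hn θ hθ
    rw [← sub_pos, tlsCriterion_sub]
    exact hn θ hθ
  · filter_upwards [ae_sample_nonneg hid] with ω hω i θ hθ θ' _
    have := PanelObs.loss_sub_le_mul_dist (hω i).1 (hω i).2 M.θ₀ θ θ'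
    rw [mem_sphere_iff_norm.1 hθ] at this
    linarith

theorem ae_tendsto_tlsEstimator (he : M.ExchangeableErrors P) (h2 : MemLp M.dX 2 P)
    (h₀ : Integrable (fun ω => (M.obs ω).score M.θ₀ • M.dX ω) P) (hj : M.JacobianRank P)
    (hindep : Pairwise fun i j => IndepFun (Z i) (Z j) Q)
    (hid : ∀ i, IdentDistrib (Z i) M.obs Q P) {θhat : ℕ → Ω' → RVec K}
    (hθ : IsTLSEstimator Z Q θhat) :
    ∀ᵐ ω ∂Q, Tendsto (fun n => θhat n ω) atTop (𝓝 M.θ₀) := by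
  have hsphere : ∀ᵐ ω ∂Q, ∀ k : ℕ, ∀ᶠ n in atTop, ∀ θ ∈ Metric.sphere M.θ₀ (1 / ((k : ℝ) + 1)),
      tlsCriterion (Z · ω) n M.θ₀ < tlsCriterion (Z · ω) n θ :=
    ae_all_iff.2 fun k =>
      ae_eventually_tlsCriterion_lt_on_sphere he h2 h₀ hj hindep hid Nat.one_div_pos_of_nat
  filter_upwards [hsphere, hθ, ae_sample_nonneg hid] with ω hsphere hmin hnonneg
  refine Metric.tendsto_nhds.2 fun ε hε => ?_
  obtain ⟨k, hk⟩ := exists_nat_one_div_lt hε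
  filter_upwards [hsphere k, eventually_ge_atTop 1] with n hn hn1
  exact (dist_lt_of_convexOn_of_forall_sphere_lt (convexOn_tlsCriterion hnonneg n)
    Nat.one_div_pos_of_nat hn (hmin n hn1 M.θ₀)).trans hk

end CensoredPanel

namespace PanelObs

variable {K : ℕ} {z : PanelObs K}

theorem abs_score_sq_mul_outer_sub_le (h₁ : 0 ≤ y₁ z) (h₂ : 0 ≤ y₂ z) (θ θ₀ : RVec K)
    (j k : Fin K) :
    |score z θ ^ 2 * outer (dx z) j k - score z θ₀ ^ 2 * outer (dx z) j k| ≤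
      2 * ‖θ - θ₀‖ * (|score z θ₀| * ‖dx z‖ ^ 3) + ‖θ - θ₀‖ ^ 2 * ‖dx z‖ ^ 4 := by
  have hdiff := abs_score_sub_le h₁ h₂ θ θ₀
  have hsq : |score z θ ^ 2 - score z θ₀ ^ 2| ≤
      ‖dx z‖ * ‖θ - θ₀‖ * (2 * |score z θ₀| + ‖dx z‖ * ‖θ - θ₀‖) := by
    have hfactor : score z θ ^ 2 - score z θ₀ ^ 2 =
        (score z θ - score z θ₀) * (2 * score z θ₀ + (score z θ - score z θ₀)) := by ring
    rw [hfactor, abs_mul]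
    gcongr
    refine (abs_add_le _ _).trans (add_le_add ?_ hdiff)
    rw [abs_mul, abs_two]
  rw [← sub_mul, abs_mul]
  calc |score z θ ^ 2 - score z θ₀ ^ 2| * |outer (dx z) j k|
      ≤ ‖dx z‖ * ‖θ - θ₀‖ * (2 * |score z θ₀| + ‖dx z‖ * ‖θ - θ₀‖) * (1 * ‖dx z‖ ^ 2) := by
        gcongr
        exact abs_outer_le _ j k
    _ = _ := by ring

end PanelObs

theorem tlsVHat_apply {K : ℕ} (z : ℕ → PanelObs K) (n : ℕ) (θ : RVec K) (j k : Fin K) :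
    tlsVHat z n θ j k = empiricalMean z n fun x => x.score θ ^ 2 * outer x.dx j k := by
  simp only [tlsVHat, empiricalMean, Matrix.smul_apply, Matrix.sum_apply, smul_eq_mul]

namespace CensoredPanel

variable {K : ℕ} {Ω Ω' : Type*} [MeasurableSpace Ω] [MeasurableSpace Ω'] {M : CensoredPanel K Ω}
  {P : Measure Ω} {Q : Measure Ω'} {Z : ℕ → Ω' → PanelObs K} {θhat : ℕ → Ω' → RVec K}

theorem integrable_abs_score_mul_norm_dX_pow (h4 : MemLp M.dX 4 P) (hV : M.VExists P) :
    Integrable (fun ω => |(M.obs ω).score M.θ₀| * ‖M.dX ω‖ ^ 3) P := by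
  have hsq : MemLp (fun ω => ‖M.dX ω‖ ^ 2) 2 P := by
    refine (memLp_two_iff_integrable_sq (by fun_prop)).2 ?_
    simp only [← pow_mul]
    exact h4.integrable_norm_pow four_ne_zero
  refine ((memLp_score_smul hV).norm.integrable_mul hsq).congr (.of_forall fun ω => ?_)
  simp only [Pi.mul_apply, norm_smul, Real.norm_eq_abs]
  ring

theorem ae_tendsto_tlsVHat (h4 : MemLp M.dX 4 P) (hV : M.VExists P)
    (hindep : Pairwise fun i j => IndepFun (Z i) (Z j) Q)
    (hid : ∀ i, IdentDistrib (Z i) M.obs Q P)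
    (hθ : ∀ᵐ ω ∂Q, Tendsto (fun n => θhat n ω) atTop (𝓝 M.θ₀)) :
    ∀ᵐ ω ∂Q, Tendsto (fun n => tlsVHat (Z · ω) n (θhat n ω)) atTop (𝓝 (M.V₀ P)) := by
  have hθ₀ : ∀ᵐ ω ∂Q, ∀ j k, Tendsto (fun n => empiricalMean (Z · ω) n
      fun z => z.score M.θ₀ ^ 2 * outer z.dx j k) atTop (𝓝 (M.V₀ P j k)) :=
    ae_all_iff.2 fun j => ae_all_iff.2 fun k =>
      ae_tendsto_empiricalMean hindep hid (by fun_prop) (hV j k)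
  filter_upwards [hθ₀, ae_sample_nonneg hid, hθ,
    ae_tendsto_empiricalMean hindep hid (f := fun z => |z.score M.θ₀| * ‖z.dx‖ ^ 3)
      (by fun_prop) (integrable_abs_score_mul_norm_dX_pow h4 hV),
    ae_tendsto_empiricalMean hindep hid (f := fun z => ‖z.dx‖ ^ 4) (by fun_prop)
      (h4.integrable_norm_pow four_ne_zero)] with ω hθ₀ hnonneg hθ hcube hfourth
  refine tendsto_pi_nhds.2 fun j => tendsto_pi_nhds.2 fun k => ?_
  have hdist : Tendsto (fun n => ‖θhat n ω - M.θ₀‖) atTop (𝓝 0) :=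
    tendsto_iff_norm_sub_tendsto_zero.1 hθ
  have hbound := ((hdist.const_mul 2).mul hcube).add ((hdist.pow 2).mul hfourth)
  simp only [mul_zero, zero_mul, add_zero, ne_eq, OfNat.ofNat_ne_zero, not_false_eq_true,
    zero_pow] at hbound
  have hdiff : Tendsto (fun n => tlsVHat (Z · ω) n (θhat n ω) j k -
      empiricalMean (Z · ω) n fun z => z.score M.θ₀ ^ 2 * outer z.dx j k) atTop (𝓝 0) := by
    refine squeeze_zero_norm (fun n => ?_) hbound
    rw [tlsVHat_apply, ← empiricalMean_sub, ← empiricalMean_const_mul, ← empiricalMean_const_mul,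
      ← empiricalMean_add]
    exact (abs_empiricalMean_le _ _ _).trans (empiricalMean_mono (fun i =>
      PanelObs.abs_score_sq_mul_outer_sub_le (hnonneg i).1 (hnonneg i).2 _ _ j k) n)
  simpa only [sub_add_cancel, zero_add] using hdiff.add (hθ₀ j k)

end CensoredPanel

namespace PanelObs

variable {K : ℕ} {z : PanelObs K}

theorem midWeight_mul_eq_add_indicator_sub (z : PanelObs K) (θ : RVec K) (g : PanelObs K → ℝ) :
    midWeight z θ * g z = (ind (0 < y₁ z) + ind (0 < y₂ z)) / 2 * g z +
      ({z | 0 < inner ℝ (dx z) θ}.indicator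
          (fun z => (ind (0 < y₂ z) - ind (0 < y₁ z)) / 2 * g z) z -
        {z | 0 < inner ℝ (dx z) (-θ)}.indicator
          (fun z => (ind (0 < y₂ z) - ind (0 < y₁ z)) / 2 * g z) z) := by
  simp only [inner_neg_right, Set.indicator, Set.mem_ofPred_eq, neg_pos]
  change _ = _ + ((if 0 < index z θ then _ else 0) - if index z θ < 0 then _ else 0)
  rcases lt_trichotomy (index z θ) 0 with h | h | h <;> grind [midWeight, ind]

/-- The midpoint weight at `θ`, except that observations with zero index at `θ₀` are weighted as at
`θ₀`. This removes the discontinuity of the midpoint weight at `θ₀`, while exchangeability of the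
errors leaves its integrals against functions of the regressors unchanged. -/
noncomputable def anchoredWeight (z : PanelObs K) (θ₀ θ : RVec K) : ℝ :=
  if index z θ₀ = 0 then midWeight z θ₀ else midWeight z θ

@[fun_prop]
theorem measurable_anchoredWeight (θ₀ θ : RVec K) :
    Measurable fun z : PanelObs K => anchoredWeight z θ₀ θ :=
  .ite (measurableSet_eq_fun (by fun_prop) measurable_const) (by fun_prop) (by fun_prop)

theorem anchoredWeight_mem_Icc (z : PanelObs K) (θ₀ θ : RVec K) :
    anchoredWeight z θ₀ θ ∈ Set.Icc 0 1 := by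
  unfold anchoredWeight
  split_ifs
  exacts [midWeight_mem_Icc z θ₀, midWeight_mem_Icc z θ]

theorem midWeight_ofErrors_add_swap (θ₀ : RVec K) (w : RVec K × RVec K × ℝ) (e : ℝ × ℝ)
    (θ : RVec K) :
    midWeight (ofErrors θ₀ w e) θ + midWeight (ofErrors θ₀ w e.swap) θ =
      anchoredWeight (ofErrors θ₀ w e) θ₀ θ + anchoredWeight (ofErrors θ₀ w e.swap) θ₀ θ := by
  have hindex (θ : RVec K) : index (ofErrors θ₀ w e.swap) θ = index (ofErrors θ₀ w e) θ := rfl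
  by_cases hanchor : index (ofErrors θ₀ w e) θ₀ = 0
  · have h₀ : (inner ℝ w.1 θ₀ : ℝ) = inner ℝ w.2.1 θ₀ := by
      rwa [index_ofErrors, inner_sub_left, sub_eq_zero] at hanchor
    have hy₁ : y₁ (ofErrors θ₀ w e.swap) = y₂ (ofErrors θ₀ w e) := by
      rw [y₁_ofErrors, y₂_ofErrors, h₀, Prod.fst_swap]
    have hy₂ : y₂ (ofErrors θ₀ w e.swap) = y₁ (ofErrors θ₀ w e) := by
      rw [y₁_ofErrors, y₂_ofErrors, h₀, Prod.snd_swap]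
    simp only [anchoredWeight, hindex, if_pos hanchor]
    simp only [midWeight, hy₁, hy₂, hindex]
    rcases lt_trichotomy (index (ofErrors θ₀ w e) θ) 0 with h | h | h <;> grind [ind]
  · simp only [anchoredWeight, hindex, if_neg hanchor]

theorem eventually_anchoredWeight_eq (z : PanelObs K) (θ₀ : RVec K) :
    ∀ᶠ θ in 𝓝 θ₀, anchoredWeight z θ₀ θ = midWeight z θ₀ := by
  have hcont : Tendsto (index z) (𝓝 θ₀) (𝓝 (index z θ₀)) :=
    (continuous_const.inner continuous_id).tendsto θ₀
  rcases lt_trichotomy (index z θ₀) 0 with h | h | h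
  · filter_upwards [hcont.eventually_lt_const h] with θ hθ
    grind [anchoredWeight, midWeight, ind]
  · exact .of_forall fun θ => if_pos h
  · filter_upwards [hcont.eventually_const_lt h] with θ hθ
    grind [anchoredWeight, midWeight, ind]

end PanelObs

theorem tlsJHat_apply {K : ℕ} (z : ℕ → PanelObs K) (n : ℕ) (θ : RVec K) (j k : Fin K) :
    tlsJHat z n θ j k = empiricalMean z n fun x => x.midWeight θ * outer x.dx j k := by
  simp only [tlsJHat, empiricalMean, Matrix.smul_apply, Matrix.sum_apply, smul_eq_mul]

theorem ae_tendstoUniformly_empiricalMean_midWeight_mul {K : ℕ} {Ω Ω' : Type*}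
    [MeasurableSpace Ω] [MeasurableSpace Ω'] {P : Measure Ω} [IsProbabilityMeasure P]
    {Q : Measure Ω'} {X : Ω → PanelObs K} {Z : ℕ → Ω' → PanelObs K}
    (hindep : Pairwise fun i j => IndepFun (Z i) (Z j) Q)
    (hid : ∀ i, IdentDistrib (Z i) X Q P) (hX : Measurable X)
    {g : PanelObs K → ℝ} (hg : Measurable g) (hint : Integrable (fun ω => g (X ω)) P) :
    ∀ᵐ ω ∂Q, TendstoUniformly
      (fun n (θ : RVec K) => empiricalMean (Z · ω) n fun z => z.midWeight θ * g z)
      (fun θ => ∫ ω, (X ω).midWeight θ * g (X ω) ∂P) atTop := by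
  let s : PanelObs K → ℝ := fun z => (ind (0 < z.y₁) + ind (0 < z.y₂)) / 2 * g z
  let a : PanelObs K → ℝ := fun z => (ind (0 < z.y₂) - ind (0 < z.y₁)) / 2 * g z
  let b : RVec K → PanelObs K → ℝ := fun θ => {z | 0 < inner ℝ z.dx θ}.indicator a
  have hdecomp (θ : RVec K) (z : PanelObs K) : z.midWeight θ * g z = s z + (b θ z - b (-θ) z) :=
    z.midWeight_mul_eq_add_indicator_sub θ g
  have hsm : Measurable s := by fun_prop (disch := measurability)
  have ham : Measurable a := by fun_prop (disch := measurability)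
  have hsi : Integrable (fun ω => s (X ω)) P :=
    hint.bdd_mul (c := 1) (by fun_prop (disch := measurability)) (.of_forall fun ω => by
      grind [ind, Real.norm_eq_abs])
  have hai : Integrable (fun ω => a (X ω)) P :=
    hint.bdd_mul (c := 1) (by fun_prop (disch := measurability)) (.of_forall fun ω => by
      grind [ind, Real.norm_eq_abs])
  have hbi (θ : RVec K) : Integrable (fun ω => b θ (X ω)) P :=
    hai.indicator (hX (measurableSet_halfSpace PanelObs.measurable_dx θ))
  have hlimit (θ : RVec K) : ∫ ω, (X ω).midWeight θ * g (X ω) ∂P =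
      ∫ ω, s (X ω) ∂P + (∫ ω, b θ (X ω) ∂P - ∫ ω, b (-θ) (X ω) ∂P) := by
    rw [← integral_sub (hbi θ) (hbi (-θ))]
    simp only [hdecomp]
    exact integral_add hsi ((hbi θ).sub (hbi (-θ)))
  filter_upwards [ae_tendsto_empiricalMean hindep hid hsm hsi,
    ae_tendstoUniformly_empiricalMean_halfSpace hindep hid hX ham hai PanelObs.measurable_dx]
    with ω hmean hunif
  simp only [hlimit]
  simp only [hdecomp, empiricalMean_add, empiricalMean_sub]
  exact TendstoUniformly.add (f := fun n _ => empiricalMean (Z · ω) n s)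
    hmean.tendstoUniformly_const (hunif.sub (hunif.comp Neg.neg))

namespace CensoredPanel

variable {K : ℕ} {Ω Ω' : Type*} [MeasurableSpace Ω] [MeasurableSpace Ω'] {M : CensoredPanel K Ω}
  {P : Measure Ω} {Q : Measure Ω'} {Z : ℕ → Ω' → PanelObs K} {θhat : ℕ → Ω' → RVec K}

theorem integral_midWeight_eq_anchoredWeight [IsFiniteMeasure P] (he : M.ExchangeableErrors P)
    (h2 : MemLp M.dX 2 P) (θ : RVec K) (j k : Fin K) :
    ∫ ω, (M.obs ω).midWeight θ * outer (M.dX ω) j k ∂P =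
      ∫ ω, (M.obs ω).anchoredWeight M.θ₀ θ * outer (M.dX ω) j k ∂P :=
  integral_weight_smul_eq_of_symm he h2 (PanelObs.measurable_midWeight θ)
    (PanelObs.midWeight_mem_Icc · θ) (PanelObs.measurable_anchoredWeight M.θ₀ θ)
    (PanelObs.anchoredWeight_mem_Icc · M.θ₀ θ)
    (fun w e => PanelObs.midWeight_ofErrors_add_swap M.θ₀ w e θ)
    (continuous_outer_apply j k) (abs_outer_le · j k)

theorem continuousAt_integral_midWeight [IsFiniteMeasure P] (he : M.ExchangeableErrors P)
    (h2 : MemLp M.dX 2 P) (j k : Fin K) :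
    ContinuousAt (fun θ => ∫ ω, (M.obs ω).midWeight θ * outer (M.dX ω) j k ∂P) M.θ₀ := by
  simp only [integral_midWeight_eq_anchoredWeight he h2]
  refine continuousAt_of_dominated (bound := fun ω => 1 * ‖M.dX ω‖ ^ 2)
    (.of_forall fun θ => ((PanelObs.measurable_anchoredWeight M.θ₀ θ).comp
      M.measurable_obs).aestronglyMeasurable.mul (by fun_prop))
    (.of_forall fun θ => .of_forall fun ω => ?_)
    ((h2.integrable_norm_pow two_ne_zero).const_mul 1) (.of_forall fun ω => ?_)
  · have hw := (M.obs ω).anchoredWeight_mem_Icc M.θ₀ θ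
    rw [norm_mul, Real.norm_of_nonneg hw.1]
    exact (mul_le_of_le_one_left (norm_nonneg _) hw.2).trans (abs_outer_le _ j k)
  · have hweight : ContinuousAt ((M.obs ω).anchoredWeight M.θ₀) M.θ₀ :=
      continuousAt_const.congr (((M.obs ω).eventually_anchoredWeight_eq M.θ₀).mono fun _ => Eq.symm)
    exact hweight.mul continuousAt_const

theorem ae_tendsto_tlsJHat [IsProbabilityMeasure P] (hc : M.ContinuousErrors P)
    (he : M.ExchangeableErrors P) (h2 : MemLp M.dX 2 P)
    (h₀ : Integrable (fun ω => (M.obs ω).score M.θ₀ • M.dX ω) P)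
    (hindep : Pairwise fun i j => IndepFun (Z i) (Z j) Q)
    (hid : ∀ i, IdentDistrib (Z i) M.obs Q P)
    (hθ : ∀ᵐ ω ∂Q, Tendsto (fun n => θhat n ω) atTop (𝓝 M.θ₀)) :
    ∀ᵐ ω ∂Q, Tendsto (fun n => tlsJHat (Z · ω) n (θhat n ω)) atTop (𝓝 (M.J₀ P)) := by
  have hint (j k : Fin K) : Integrable (fun ω => outer (M.dX ω) j k) P :=
    ((h2.integrable_norm_pow two_ne_zero).const_mul 1).mono' (by fun_prop)
      (.of_forall fun ω => abs_outer_le _ j k)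
  have hunif : ∀ᵐ ω ∂Q, ∀ j k, TendstoUniformly
      (fun n (θ : RVec K) => empiricalMean (Z · ω) n fun z => z.midWeight θ * outer z.dx j k)
      (fun θ => ∫ ω, (M.obs ω).midWeight θ * outer (M.dX ω) j k ∂P) atTop :=
    ae_all_iff.2 fun j => ae_all_iff.2 fun k =>
      ae_tendstoUniformly_empiricalMean_midWeight_mul (g := fun z => outer z.dx j k) hindep hid
        M.measurable_obs (by fun_prop) (hint j k)
  filter_upwards [hunif, hθ] with ω hunif hθ
  refine tendsto_pi_nhds.2 fun j => tendsto_pi_nhds.2 fun k => ?_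
  simp only [tlsJHat_apply, J₀_apply hc he h2 h₀]
  exact (hunif j k).tendsto_comp (continuousAt_integral_midWeight he h2 j k) hθ

end CensoredPanel

section MatrixInverse

variable {ι m 𝕜 : Type*} [Fintype m] [DecidableEq m] [Field 𝕜] [TopologicalSpace 𝕜]
  [IsTopologicalRing 𝕜] {l : Filter ι} {A : ι → Matrix m m 𝕜} {A₀ : Matrix m m 𝕜}

theorem eventually_isUnit_det_of_tendsto [T1Space 𝕜] (hA : Tendsto A l (𝓝 A₀))
    (hA₀ : IsUnit A₀.det) : ∀ᶠ i in l, IsUnit (A i).det :=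
  ((((continuous_id.matrix_det).tendsto A₀).comp hA).eventually_ne hA₀.ne_zero).mono
    fun _ => IsUnit.mk0 _

theorem tendsto_matrix_inv [ContinuousInv₀ 𝕜] (hA : Tendsto A l (𝓝 A₀)) (hA₀ : IsUnit A₀.det) :
    Tendsto (fun i => (A i)⁻¹) l (𝓝 A₀⁻¹) := by
  refine (continuousAt_matrix_inv A₀ ?_).tendsto.comp hA
  rw [Ring.inverse_eq_inv']
  exact continuousAt_inv₀ hA₀.ne_zero

end MatrixInverse

open CensoredPanel in
theorem theorem3_general {K : ℕ}
    {Ω : Type*} [MeasurableSpace Ω] (P : Measure Ω) [IsProbabilityMeasure P]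
    (M : CensoredPanel K Ω)
    (h4 : MemLp M.dX 4 P)
    (h_cont : M.ContinuousErrors P)
    (h_exch : M.ExchangeableErrors P)
    (h_jac : M.JacobianRank P)
    (hV_exists : M.VExists P)
    {Ω' : Type*} [MeasurableSpace Ω'] (Q : Measure Ω')
    (Z : ℕ → Ω' → PanelObs K) (hindep : Pairwise fun i j => IndepFun (Z i) (Z j) Q)
    (hid : ∀ i, IdentDistrib (Z i) M.obs Q P)
    (θhat : ℕ → Ω' → RVec K) (hθ : IsTLSEstimator Z Q θhat) :
    (∀ θ, Integrable (fun ω => (M.obs ω).score θ • M.dX ω) P) ∧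
    DifferentiableAt ℝ (M.G P) M.θ₀ ∧
    (∀ᵐ ω ∂Q, Tendsto (fun n => tlsVHat (Z · ω) n (θhat n ω)) atTop (𝓝 (M.V₀ P))) ∧
    (∀ᵐ ω ∂Q, Tendsto (fun n => tlsJHat (Z · ω) n (θhat n ω)) atTop (𝓝 (M.J₀ P))) ∧
    IsUnit (M.J₀ P).det ∧
    (∀ᵐ ω ∂Q, ∀ᶠ n in atTop, IsUnit (tlsJHat (Z · ω) n (θhat n ω)).det) ∧
    (∀ᵐ ω ∂Q, Tendsto
      (fun n => (tlsJHat (Z · ω) n (θhat n ω))⁻¹ *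
        tlsVHat (Z · ω) n (θhat n ω) *
        (tlsJHat (Z · ω) n (θhat n ω))⁻¹)
      atTop (𝓝 ((M.J₀ P)⁻¹ * M.V₀ P * (M.J₀ P)⁻¹))) := by
  have h2 : MemLp M.dX 2 P := h4.mono_exponent (by norm_num)
  have h₀ := (memLp_score_smul hV_exists).integrable one_le_two
  have hconsistent := ae_tendsto_tlsEstimator h_exch h2 h₀ h_jac hindep hid hθ
  have hVhat := ae_tendsto_tlsVHat h4 hV_exists hindep hid hconsistent
  have hJhat := ae_tendsto_tlsJHat h_cont h_exch h2 h₀ hindep hid hconsistent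
  have hJ₀ := isUnit_det_J₀ h_cont h_exch h2 h₀ h_jac
  refine ⟨integrable_score_smul h2 h₀, (hasFDerivAt_G h_cont h_exch h2 h₀).differentiableAt,
    hVhat, hJhat, hJ₀, ?_, ?_⟩
  · filter_upwards [hJhat] with ω hJ
    exact eventually_isUnit_det_of_tendsto hJ hJ₀
  · filter_upwards [hVhat, hJhat] with ω hV hJ
    have hJinv := tendsto_matrix_inv hJ hJ₀
    exact (hJinv.mul hV).mul hJinv

theorem theorem3 {K : ℕ}
    {Ω : Type*} [MeasurableSpace Ω] (P : Measure Ω) [IsProbabilityMeasure P]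
    (M : CensoredPanel K Ω)
    (h_nondeg : M.NonDegenerate P)
    (h_mom : M.MomentConditions P)
    (h_cont : M.ContinuousErrors P)
    (h_exch : M.ExchangeableErrors P)
    (h_rank : M.RankRegressors P)
    (h_jac : M.JacobianRank P)
    (hV_exists : M.VExists P)
    (hV_rank : (M.V₀ P).rank = K)
    {Ω' : Type*} [MeasurableSpace Ω'] (Q : Measure Ω') [IsProbabilityMeasure Q]
    (Z : ℕ → Ω' → PanelObs K) (hZ : IsRandomSample M P Z Q)
    (θhat : ℕ → Ω' → RVec K) (hθ : IsTLSEstimator Z Q θhat) :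
    -- the expected score is well defined and differentiable at `θ₀`, so that `J₀` is meaningful
    (∀ θ, Integrable (fun ω => (M.obs ω).score θ • M.dX ω) P) ∧
    DifferentiableAt ℝ (M.G P) M.θ₀ ∧
    -- strong consistency of the two plug-in estimators
    (∀ᵐ ω ∂Q, Tendsto (fun n => tlsVHat (fun i => Z i ω) n (θhat n ω)) atTop (𝓝 (M.V₀ P))) ∧
    (∀ᵐ ω ∂Q, Tendsto (fun n => tlsJHat (fun i => Z i ω) n (θhat n ω)) atTop (𝓝 (M.J₀ P))) ∧
    -- strong consistency of the sandwich estimator, whose inverses are genuine in the limit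
    IsUnit (M.J₀ P).det ∧
    (∀ᵐ ω ∂Q, ∀ᶠ n in atTop, IsUnit (tlsJHat (fun i => Z i ω) n (θhat n ω)).det) ∧
    (∀ᵐ ω ∂Q, Tendsto
      (fun n => (tlsJHat (fun i => Z i ω) n (θhat n ω))⁻¹ *
        tlsVHat (fun i => Z i ω) n (θhat n ω) *
        (tlsJHat (fun i => Z i ω) n (θhat n ω))⁻¹)
      atTop (𝓝 ((M.J₀ P)⁻¹ * M.V₀ P * (M.J₀ P)⁻¹))) :=
  theorem3_general P M (CensoredPanel.memLp_dX_four h_mom) h_cont h_exch h_jac hV_exists Q Z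
    (fun _ _ hij => hZ.1.indepFun hij) hZ.2 θhat hθ
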